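/- Let $\mu$ be a nontrivial positive measure on the unit circle $\mathbb{T}$, i.e. a finite positive Borel measure whose support is an infinite set. Let $\Phi_n$, $n\ge 0$, be its monic orthogonal polynomials ($\Phi_n$ is monic of degree $n$ and $\int_{\mathbb{T}}\Phi_n\overline{\Phi_m}\,d\mu=0$ for $n\neq m$), and let $\alpha_n=-\overline{\Phi_{n+1}(0)}$, $n\ge 0$, be its Verblunsky coefficients. For $\vartheta>0$ define $$\tau_0^{(\vartheta)}=e^{i\vartheta},\qquad \tau_n^{(\vartheta)}=e^{i\vartheta}\,\tau_{n-1}^{(\vartheta)}\,\frac{1-\overline{\tau_{n-1}^{(\vartheta)}\alpha_{n-1}}}{1-\tau_{n-1}^{(\vartheta)}\alpha_{n-1}},\quad n\ge 1,$$ $$c_n^{(\vartheta)}=\frac{-\operatorname{Im}(\tau_{n-1}^{(\vartheta)}\alpha_{n-1})}{1-\operatorname{Re}(\tau_{n-1}^{(\vartheta)}\alpha_{n-1})},\qquad g_n^{(\vartheta)}=\frac12\,\frac{|1-\tau_{n-1}^{(\vartheta)}\alpha_{n-1}|^2}{1-\operatorname{Re}(\tau_{n-1}^{(\vartheta)}\alpha_{n-1})},\qquad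 d_{n+1}^{(\vartheta)}=(1-g_n^{(\vartheta)})\,g_{n+1}^{(\vartheta)},\quad n\ge 1,$$ and, for $x\in[-1,1]$, $$\mathfrak d_{n+1}^{(\vartheta)}(x)=\frac{d_{n+1}^{(\vartheta)}}{\big(x-c_n^{(\vartheta)}\sqrt{1-x^2}\big)\big(x-c_{n+1}^{(\vartheta)}\sqrt{1-x^2}\big)},\quad n\ge 1.$$ Let $\vartheta_1,\vartheta_2\in\mathbb{R}$ satisfy $0<\vartheta_2-\vartheta_1\le 2\pi$ and $\vartheta_2>0$, put $x(\vartheta_1,\vartheta_2)=\cos\big((2\pi+\vartheta_1-\vartheta_2)/2\big)$ and $$\mathfrak m_0^{(\vartheta_1,\vartheta_2)}=0,\qquad \mathfrak m_n^{(\vartheta_1,\vartheta_2)}=\frac{\mathfrak d_{n+1}^{(\vartheta_2)}\big(x(\vartheta_1,\vartheta_2)\big)}{1-\mathfrak m_{n-1}^{(\vartheta_1,\vartheta_2)}},\quad n\ge 1.$$ Let $\mathcal A(\vartheta_1,\vartheta_2)=\{e^{i\theta}:\vartheta_1<\theta<\vartheta_2\}$. Then $$\operatorname{supp}\mu\cap\mathcal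 A(\vartheta_1,\vartheta_2)=\emptyset$$ if and only if $$\cot\big((2\pi+\vartheta_1-\vartheta_2)/2\big)<c_1^{(\vartheta_2)}\quad\text{and}\quad 0<\mathfrak m_n^{(\vartheta_1,\vartheta_2)}<1\ \text{ for all } n\ge 1.$$ Here $\cot 0=+\infty$ (this occurs only if $\vartheta_2-\vartheta_1=2\pi$), and if a denominator in the definition of the $\mathfrak m_n^{(\vartheta_1,\vartheta_2)}$ vanishes, the condition $0<\mathfrak m_n^{(\vartheta_1,\vartheta_2)}<1$ for all $n\geq 1$ is understood to fail. -/

import Mathlib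

open MeasureTheory Polynomial
open scoped ComplexConjugate

namespace RotatedOPUC

noncomputable section

/-- The unit circle carries its Borel σ-algebra. -/
instance instMeasurableSpaceCircle : MeasurableSpace Circle := borel Circle

instance instBorelSpaceCircle : BorelSpace Circle := ⟨rfl⟩

/-- The Hermitian form `⟨p, q⟩ = ∫_𝕋 p(z) conj(q(z)) dμ(z)` on complex polynomials. -/
def ip (μ : Measure Circle) (p q : ℂ[X]) : ℂ :=
  ∫ z : Circle, p.eval (z : ℂ) * conj (q.eval (z : ℂ)) ∂μ

/-- The monic orthogonal polynomials `Φ_n` of `μ`, obtained from `1, z, z², …` by the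
Gram-Schmidt process (without normalisation). -/
def monicOPUC (μ : Measure Circle) (n : ℕ) : ℂ[X] :=
  X ^ n - ∑ j : Fin n,
    C (ip μ (X ^ n) (monicOPUC μ j) / ip μ (monicOPUC μ j) (monicOPUC μ j)) * monicOPUC μ j
termination_by n
decreasing_by all_goals exact j.isLt

/-- The Verblunsky coefficients `α_n = -conj (Φ_{n+1}(0))`, `n ≥ 0`. -/
def verblunsky (μ : Measure Circle) (n : ℕ) : ℂ :=
  -conj ((monicOPUC μ (n + 1)).eval 0)

/-- `τ_0 = e^{iϑ}`, `τ_n = e^{iϑ} τ_{n-1} (1 - conj (τ_{n-1} α_{n-1})) / (1 - τ_{n-1} α_{n-1})`. -/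
def tau (α : ℕ → ℂ) (ϑ : ℝ) : ℕ → ℂ
  | 0 => Complex.exp (Complex.I * ϑ)
  | n + 1 => Complex.exp (Complex.I * ϑ) * tau α ϑ n *
      ((1 - conj (tau α ϑ n * α n)) / (1 - tau α ϑ n * α n))

/-- `c_n^{(ϑ)}` for `n ≥ 1`. -/
def cCoeff (α : ℕ → ℂ) (ϑ : ℝ) (n : ℕ) : ℝ :=
  -(tau α ϑ (n - 1) * α (n - 1)).im / (1 - (tau α ϑ (n - 1) * α (n - 1)).re)

/-- `g_n^{(ϑ)}` for `n ≥ 1`. -/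
def gCoeff (α : ℕ → ℂ) (ϑ : ℝ) (n : ℕ) : ℝ :=
  1 / 2 * (‖1 - tau α ϑ (n - 1) * α (n - 1)‖ ^ 2 / (1 - (tau α ϑ (n - 1) * α (n - 1)).re))

/-- `dSucc α ϑ n` is `d_{n+1}^{(ϑ)} = (1 - g_n^{(ϑ)}) g_{n+1}^{(ϑ)}`, for `n ≥ 1`. -/
def dSucc (α : ℕ → ℂ) (ϑ : ℝ) (n : ℕ) : ℝ :=
  (1 - gCoeff α ϑ n) * gCoeff α ϑ (n + 1)

/-- `dFrakSucc α ϑ n x` is `𝔡_{n+1}^{(ϑ)}(x)`, for `n ≥ 1` and `x ∈ [-1, 1]`. -/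
def dFrakSucc (α : ℕ → ℂ) (ϑ : ℝ) (n : ℕ) (x : ℝ) : ℝ :=
  dSucc α ϑ n /
    ((x - cCoeff α ϑ n * √(1 - x ^ 2)) * (x - cCoeff α ϑ (n + 1) * √(1 - x ^ 2)))

/-- `x(ϑ₁, ϑ₂) = cos ((2π + ϑ₁ - ϑ₂) / 2)`. -/
def xPoint (ϑ₁ ϑ₂ : ℝ) : ℝ :=
  Real.cos ((2 * Real.pi + ϑ₁ - ϑ₂) / 2)

/-- `𝔪_0 = 0`, `𝔪_n = 𝔡_{n+1}^{(ϑ₂)}(x(ϑ₁, ϑ₂)) / (1 - 𝔪_{n-1})` for `n ≥ 1`. -/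
def mSeq (α : ℕ → ℂ) (ϑ₁ ϑ₂ : ℝ) : ℕ → ℝ
  | 0 => 0
  | n + 1 => dFrakSucc α ϑ₂ (n + 1) (xPoint ϑ₁ ϑ₂) / (1 - mSeq α ϑ₁ ϑ₂ n)

/-- The cotangent on `[0, π)`, with the value `cot 0 = +∞` (the limit from the right). -/
def cotTop (φ : ℝ) : EReal :=
  if φ = 0 then ⊤ else (Real.cot φ : EReal)

/-- The open arc `{e^{iθ} : ϑ₁ < θ < ϑ₂}`. -/
def openArc (ϑ₁ ϑ₂ : ℝ) : Set Circle :=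
  Circle.exp '' Set.Ioo ϑ₁ ϑ₂

end

end RotatedOPUC

/-!
The weight `w(e^{iθ}) = 2 (cos ((ϑ₂ - ϑ₁) / 2) - cos (θ - (ϑ₁ + ϑ₂) / 2))` is negative exactly on
the arc, so the arc carries no support if and only if `∫ |p|² w dμ ≥ 0` for every polynomial `p`:
by Stone–Weierstrass, `|p|` may be replaced by an arbitrary continuous function. With
`z₁ = e^{iϑ₁}` and `z₂ = e^{iϑ₂}`, the weight is a unimodular multiple of `(z - z₁) conj(z - z₂)`,
so Christoffel's formula diagonalises this Hermitian form. Up to positive factors its diagonal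
entries are `-V_n V_{n+1}`, `n ≥ 1`, where `V_n` is the Christoffel–Darboux kernel
`K_n(z₁, z₂)` multiplied by a phase that makes it real; the form is therefore nonnegative if and
only if `V_1, V_2, …` alternate in sign. Finally `V_n` satisfies the three-term recurrence
`(1 - g_n) V_{n+1} = (cos φ - c_n sin φ) V_n - g_n V_{n-1}` with `φ = (2π + ϑ₁ - ϑ₂) / 2`. The
ratios of its left-hand side to the `V_n` term obey the recursion of `1 - 𝔪_{n-1}`, which turns
the alternation of signs into the conditions on `cot φ` and `𝔪_n`.
-/

namespace RotatedOPUC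

section DegreeLT

variable {R : Type*} [Ring R] {n : ℕ} {p q : R[X]}

lemma mem_degreeLT_iff_coeff_eq_zero : p ∈ degreeLT R n ↔ ∀ m, n ≤ m → p.coeff m = 0 := by
  rw [mem_degreeLT, degree_lt_iff_coeff_zero]

lemma coeff_eq_zero_of_mem_degreeLT (hp : p ∈ degreeLT R n) {m : ℕ} (hm : n ≤ m) :
    p.coeff m = 0 :=
  mem_degreeLT_iff_coeff_eq_zero.1 hp m hm

lemma mem_degreeLT_of_coeff_eq_zero (hp : p ∈ degreeLT R (n + 1)) (h : p.coeff n = 0) :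
    p ∈ degreeLT R n := by
  refine mem_degreeLT_iff_coeff_eq_zero.2 fun m hm => ?_
  rcases hm.eq_or_lt with rfl | hm
  · exact h
  · exact coeff_eq_zero_of_mem_degreeLT hp hm

lemma sub_smul_mem_degreeLT (hp : p ∈ degreeLT R (n + 1)) (hq : q ∈ degreeLT R (n + 1)) {c : R}
    (h : p.coeff n = c * q.coeff n) : p - c • q ∈ degreeLT R n :=
  mem_degreeLT_of_coeff_eq_zero (sub_mem hp (Submodule.smul_mem _ c hq)) <| by
    rw [coeff_sub, coeff_smul, smul_eq_mul, h, sub_self]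

lemma X_mul_mem_degreeLT (hp : p ∈ degreeLT R n) : X * p ∈ degreeLT R (n + 1) := by
  refine mem_degreeLT_iff_coeff_eq_zero.2 fun m hm => ?_
  obtain ⟨m, rfl⟩ := Nat.exists_eq_succ_of_ne_zero (n.succ_pos.trans_le hm).ne'
  rw [coeff_X_mul]
  exact coeff_eq_zero_of_mem_degreeLT hp (by lia)

lemma mem_degreeLT_of_X_mul_mem (hp : X * p ∈ degreeLT R (n + 1)) : p ∈ degreeLT R n :=
  mem_degreeLT_iff_coeff_eq_zero.2 fun m hm => by
    rw [← coeff_X_mul, coeff_eq_zero_of_mem_degreeLT hp (by lia)]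

lemma X_sub_C_mul_mem_degreeLT (a : R) (hp : p ∈ degreeLT R n) :
    (X - C a) * p ∈ degreeLT R (n + 1) := by
  rw [sub_mul, ← smul_eq_C_mul]
  exact sub_mem (X_mul_mem_degreeLT hp)
    (degreeLT_mono n.le_succ (Submodule.smul_mem _ a hp))

lemma coeff_X_sub_C_mul_of_mem_degreeLT (a : R) (hp : p ∈ degreeLT R (n + 1)) :
    ((X - C a) * p).coeff (n + 1) = p.coeff n := by
  rw [sub_mul, coeff_sub, coeff_X_mul, coeff_C_mul, coeff_eq_zero_of_mem_degreeLT hp le_rfl,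
    mul_zero, sub_zero]

lemma mem_degreeLT_of_X_sub_C_mul_mem [Nontrivial R] {a : R}
    (hp : (X - C a) * p ∈ degreeLT R (n + 1)) : p ∈ degreeLT R n := by
  rw [mem_degreeLT, (monic_X_sub_C a).degree_mul_comm, (monic_X_sub_C a).degree_mul,
    degree_X_sub_C, Nat.cast_add, Nat.cast_one] at hp
  exact mem_degreeLT.2 ((WithBot.add_lt_add_iff_right WithBot.one_ne_bot).1 hp)

lemma eqOn_degreeLT_of_sequence {𝕜 M : Type*} [Field 𝕜] [AddCommMonoid M] [Module 𝕜 M]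
    (S : Polynomial.Sequence 𝕜) {L₁ L₂ : 𝕜[X] →ₗ[𝕜] M} {n : ℕ}
    (h : ∀ j < n, L₁ (S j) = L₂ (S j)) : Set.EqOn L₁ L₂ (degreeLT 𝕜 n) := by
  rw [← S.span_degreeLT fun i _ => (leadingCoeff_ne_zero.2 (S.ne_zero i)).isUnit]
  refine LinearMap.eqOn_span' ?_
  rintro _ ⟨j, hj, rfl⟩
  exact h j hj

end DegreeLT

section NonnegForm

open scoped ComplexOrder

variable {𝕜 : Type*} [RCLike 𝕜] {B : 𝕜[X] →ₗ⋆[𝕜] 𝕜[X] →ₗ[𝕜] 𝕜}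

lemma isNonneg_of_orthogonal (hB : B.IsSymm) {f : ℕ → 𝕜[X]}
    (hf : ∀ n, f n ∈ degreeLT 𝕜 (n + 1)) (hcoeff : ∀ n, (f n).coeff n ≠ 0)
    (horth : ∀ n, ∀ q ∈ degreeLT 𝕜 n, B q (f n) = 0) (hpos : ∀ n, 0 ≤ B (f n) (f n)) :
    B.IsNonneg := by
  have nonneg_of_mem : ∀ n, ∀ p ∈ degreeLT 𝕜 n, 0 ≤ B p p := by
    intro n
    induction n with
    | zero =>
      intro p hp
      have hp0 : p = 0 := by simpa [mem_degreeLT] using hp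
      simp [hp0]
    | succ n ih =>
      intro p hp
      set c := p.coeff n / (f n).coeff n
      have hr : p - c • f n ∈ degreeLT 𝕜 n :=
        sub_smul_mem_degreeLT hp (hf n) (div_mul_cancel₀ _ (hcoeff n)).symm
      set r := p - c • f n with hrdef
      have hfr : B (f n) r = 0 := by rw [← hB.eq, horth n r hr, map_zero]
      have pythagoras : B p p = B r r + conj c * c * B (f n) (f n) := by
        rw [show p = r + c • f n by rw [hrdef, sub_add_cancel]]
        simp only [map_add, LinearMap.add_apply, map_smulₛₗ, LinearMap.smul_apply, smul_eq_mul,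
          horth n r hr, hfr, RingHom.id_apply]
        ring
      rw [pythagoras]
      exact add_nonneg (ih r hr) (mul_nonneg (star_mul_self_nonneg c) (hpos n))
  refine ⟨fun p => nonneg_of_mem (p.natDegree + 1) p (mem_degreeLT.2 ?_)⟩
  exact degree_le_natDegree.trans_lt (by exact_mod_cast p.natDegree.lt_succ_self)

end NonnegForm

section SesqForm

variable (μ : Measure Circle)

lemma circle_mul_conj (z : Circle) : (z : ℂ) * conj (z : ℂ) = 1 := by
  rw [Complex.mul_conj, Circle.normSq_coe, Complex.ofReal_one]

lemma continuous_eval_circle (p : ℂ[X]) : Continuous fun z : Circle => p.eval (z : ℂ) :=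
  p.continuous.comp continuous_subtype_val

lemma integrable_of_continuous_circle [IsFiniteMeasure μ] {E : Type*} [NormedAddCommGroup E]
    {f : Circle → E} (hf : Continuous f) : Integrable f μ :=
  hf.integrable_of_hasCompactSupport (.of_compactSpace f)

lemma integrable_mul_eval_mul_conj_eval [IsFiniteMeasure μ] (s : C(Circle, ℝ)) (p q : ℂ[X]) :
    Integrable (fun z : Circle => (s z : ℂ) * (p.eval (z : ℂ) * conj (q.eval (z : ℂ)))) μ :=
  integrable_of_continuous_circle μ <| (Complex.continuous_ofReal.comp s.continuous).mul <|
    (continuous_eval_circle p).mul (Complex.continuous_conj.comp (continuous_eval_circle q))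

/-- The Hermitian form `⟨p, q⟩ = ∫ p conj(q) s dμ` with a real weight `s`. As in Mathlib's inner
products, the conjugate-linear argument `q` comes first. -/
noncomputable def sesqForm [IsFiniteMeasure μ] (s : C(Circle, ℝ)) :
    ℂ[X] →ₗ⋆[ℂ] ℂ[X] →ₗ[ℂ] ℂ :=
  LinearMap.mk₂'ₛₗ (starRingEnd ℂ) (RingHom.id ℂ)
    (fun q p => ∫ z : Circle, (s z : ℂ) * (p.eval (z : ℂ) * conj (q.eval (z : ℂ))) ∂μ)
    (fun q₁ q₂ p => by
      simp only [eval_add, map_add, mul_add]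
      exact integral_add (integrable_mul_eval_mul_conj_eval μ s p q₁)
        (integrable_mul_eval_mul_conj_eval μ s p q₂))
    (fun c q p => by
      rw [smul_eq_mul, ← integral_const_mul]
      congr 1 with z
      rw [eval_smul, smul_eq_mul, map_mul]
      ring)
    (fun q p₁ p₂ => by
      simp only [eval_add, add_mul, mul_add]
      exact integral_add (integrable_mul_eval_mul_conj_eval μ s p₁ q)
        (integrable_mul_eval_mul_conj_eval μ s p₂ q))
    (fun c q p => by
      rw [RingHom.id_apply, smul_eq_mul, ← integral_const_mul]
      congr 1 with z
      rw [eval_smul, smul_eq_mul]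
      ring)

lemma sesqForm_apply [IsFiniteMeasure μ] (s : C(Circle, ℝ)) (p q : ℂ[X]) : sesqForm μ s q p =
    ∫ z : Circle, (s z : ℂ) * (p.eval (z : ℂ) * conj (q.eval (z : ℂ))) ∂μ :=
  rfl

lemma isSymm_sesqForm [IsFiniteMeasure μ] (s : C(Circle, ℝ)) : (sesqForm μ s).IsSymm := by
  refine ⟨fun p q => ?_⟩
  rw [sesqForm_apply, sesqForm_apply, ← integral_conj]
  congr 1 with z
  simp only [map_mul, Complex.conj_ofReal, Complex.conj_conj]
  ring

lemma sesqForm_self [IsFiniteMeasure μ] (s : C(Circle, ℝ)) (p : ℂ[X]) :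
    sesqForm μ s p p = ((∫ z : Circle, s z * ‖p.eval (z : ℂ)‖ ^ 2 ∂μ : ℝ) : ℂ) := by
  rw [sesqForm_apply, ← integral_complex_ofReal]
  congr 1 with z
  rw [Complex.mul_conj, Complex.normSq_eq_norm_sq, Complex.ofReal_mul]

lemma ip_eq_sesqForm [IsFiniteMeasure μ] (p q : ℂ[X]) : ip μ p q = sesqForm μ 1 q p := by
  simp only [ip, sesqForm_apply, ContinuousMap.one_apply, Complex.ofReal_one, one_mul]

lemma conj_ip [IsFiniteMeasure μ] (p q : ℂ[X]) : conj (ip μ p q) = ip μ q p := by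
  rw [ip_eq_sesqForm, ip_eq_sesqForm, (isSymm_sesqForm μ 1).eq]

lemma ip_eq_zero_comm [IsFiniteMeasure μ] {p q : ℂ[X]} : ip μ p q = 0 ↔ ip μ q p = 0 := by
  rw [← conj_ip, map_eq_zero]

lemma ip_X_mul_X_mul (p q : ℂ[X]) : ip μ (X * p) (X * q) = ip μ p q := by
  rw [ip, ip]
  congr 1 with z
  simp only [eval_mul, eval_X, map_mul]
  linear_combination (p.eval (z : ℂ) * conj (q.eval (z : ℂ))) * circle_mul_conj z

end SesqForm

section Positivity

lemma eq_zero_of_mem_support_of_integral_eq_zero {Y : Type*} [TopologicalSpace Y]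
    [HereditarilyLindelofSpace Y] [MeasurableSpace Y] {μ : Measure Y} {f : Y → ℝ}
    (hf : Continuous f) (hint : Integrable f μ) (hnonneg : ∀ z ∈ μ.support, 0 ≤ f z)
    (h : ∫ z, f z ∂μ = 0) {z : Y} (hz : z ∈ μ.support) : f z = 0 := by
  have hae : ∀ᵐ z ∂μ, 0 ≤ f z := Filter.Eventually.mono Measure.support_mem_ae hnonneg
  exact Measure.support_subset_of_isClosed (isClosed_eq hf continuous_const)
    ((integral_eq_zero_iff_of_nonneg_ae hae hint).1 h) hz

lemma continuous_integral_continuousMap {Y : Type*} [TopologicalSpace Y] [CompactSpace Y]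
    [MeasurableSpace Y] [BorelSpace Y] (μ : Measure Y) [IsFiniteMeasure μ] :
    Continuous fun f : C(Y, ℝ) => ∫ z, f z ∂μ := by
  have integral_toLp (f : C(Y, ℝ)) : ∫ z, f z ∂μ = ∫ z, ContinuousMap.toLp 1 μ ℝ f z ∂μ :=
    (integral_congr_ae (ContinuousMap.coeFn_toLp μ f)).symm
  simp only [integral_toLp]
  exact continuous_integral.comp (ContinuousMap.toLp 1 μ ℝ).continuous

/-- The Laurent polynomials, as a star subalgebra of the continuous functions on the circle. -/
noncomputable def laurentSubalgebra : StarSubalgebra ℂ C(Circle, ℂ) :=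
  StarAlgebra.adjoin ℂ {⟨fun z : Circle => (z : ℂ), continuous_subtype_val⟩}

lemma topologicalClosure_laurentSubalgebra : laurentSubalgebra.topologicalClosure = ⊤ := by
  refine ContinuousMap.starSubalgebra_topologicalClosure_eq_top_of_separatesPoints _ ?_
  exact fun z w hzw => ⟨_, ⟨_, StarAlgebra.self_mem_adjoin_singleton ℂ _, rfl⟩,
    fun h => hzw (Circle.coe_injective h)⟩

lemma exists_pow_mul_eq_eval_of_mem_laurentSubalgebra {f : C(Circle, ℂ)}
    (hf : f ∈ laurentSubalgebra) :
    ∃ (N : ℕ) (p : ℂ[X]), ∀ z : Circle, (z : ℂ) ^ N * f z = p.eval (z : ℂ) := by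
  rw [laurentSubalgebra, ← StarSubalgebra.mem_toSubalgebra,
    StarAlgebra.adjoin_toSubalgebra] at hf
  induction hf using Algebra.adjoin_induction with
  | mem f hf =>
    rcases hf with rfl | hf
    · exact ⟨0, X, fun z => by rw [pow_zero, one_mul, eval_X]; rfl⟩
    · refine ⟨1, 1, fun z => ?_⟩
      rw [← star_star f, Set.mem_singleton_iff.1 (Set.mem_star.1 hf), pow_one, eval_one]
      exact circle_mul_conj z
  | algebraMap r => exact ⟨0, C r, fun z => by simp⟩
  | add f g _ _ hf hg =>
    obtain ⟨N, p, hp⟩ := hf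
    obtain ⟨M, q, hq⟩ := hg
    refine ⟨N + M, X ^ M * p + X ^ N * q, fun z => ?_⟩
    simp only [eval_add, eval_mul, eval_pow, eval_X, ← hp, ← hq, ContinuousMap.add_apply]
    ring
  | mul f g _ _ hf hg =>
    obtain ⟨N, p, hp⟩ := hf
    obtain ⟨M, q, hq⟩ := hg
    refine ⟨N + M, p * q, fun z => ?_⟩
    simp only [eval_mul, ← hp, ← hq, ContinuousMap.mul_apply]
    ring

open scoped ComplexOrder

variable {μ : Measure Circle} [IsFiniteMeasure μ] {s : C(Circle, ℝ)}

lemma isNonneg_sesqForm_iff_integral :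
    (sesqForm μ s).IsNonneg ↔ ∀ p : ℂ[X], 0 ≤ ∫ z : Circle, s z * ‖p.eval (z : ℂ)‖ ^ 2 ∂μ := by
  simp only [LinearMap.isNonneg_def, sesqForm_self, Complex.zero_le_real]

lemma integral_mul_norm_sq_nonneg (hs : (sesqForm μ s).IsNonneg) (f : C(Circle, ℂ)) :
    0 ≤ ∫ z, s z * ‖f z‖ ^ 2 ∂μ := by
  let weightedNormSq (f : C(Circle, ℂ)) : C(Circle, ℝ) :=
    s * ContinuousMap.comp ⟨fun c : ℂ => ‖c‖ ^ 2, by fun_prop⟩ f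
  have hcont : Continuous weightedNormSq :=
    continuous_const.mul (ContinuousMap.continuous_postcomp _)
  have hclosed : IsClosed {f | 0 ≤ ∫ z, weightedNormSq f z ∂μ} :=
    isClosed_le continuous_const ((continuous_integral_continuousMap μ).comp hcont)
  have hlaurent : (laurentSubalgebra : Set C(Circle, ℂ)) ⊆
      {f | 0 ≤ ∫ z, weightedNormSq f z ∂μ} := by
    intro g hg
    obtain ⟨N, p, hp⟩ := exists_pow_mul_eq_eval_of_mem_laurentSubalgebra hg
    have norm_eval (z : Circle) : ‖p.eval (z : ℂ)‖ = ‖g z‖ := by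
      rw [← hp, norm_mul, norm_pow, Circle.norm_coe, one_pow, one_mul]
    have h := isNonneg_sesqForm_iff_integral.1 hs p
    simp only [norm_eval] at h
    exact h
  have hf : f ∈ laurentSubalgebra.topologicalClosure := by
    rw [topologicalClosure_laurentSubalgebra]
    trivial
  exact hclosed.closure_subset_iff.2 hlaurent hf

lemma nonneg_of_mem_support (hs : (sesqForm μ s).IsNonneg) {z : Circle} (hz : z ∈ μ.support) :
    0 ≤ s z := by
  let f : C(Circle, ℂ) := ⟨fun z => ((max (-s z) 0 : ℝ) : ℂ), by fun_prop⟩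
  have mul_norm_sq (z : Circle) : s z * ‖f z‖ ^ 2 = -max (-s z) 0 ^ 3 := by
    have norm_f : ‖f z‖ = max (-s z) 0 := by
      rw [ContinuousMap.coe_mk, Complex.norm_real, Real.norm_of_nonneg (le_max_right _ _)]
    rw [norm_f]
    rcases le_total (-s z) 0 with h | h
    · rw [max_eq_right h]; ring
    · rw [max_eq_left h]; ring
  have hle := integral_mul_norm_sq_nonneg hs f
  simp only [mul_norm_sq, integral_neg] at hle
  have hcont : Continuous fun z => max (-s z) 0 ^ 3 := by fun_prop
  have hcube : max (-s z) 0 ^ 3 = 0 :=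
    eq_zero_of_mem_support_of_integral_eq_zero hcont (integrable_of_continuous_circle μ hcont)
      (fun _ _ => by positivity)
      (le_antisymm (by linarith) (integral_nonneg fun z => by positivity)) hz
  have hmax : max (-s z) 0 = 0 := by simpa using hcube
  linarith [le_max_left (-s z) 0]

lemma isNonneg_sesqForm_iff : (sesqForm μ s).IsNonneg ↔ ∀ z ∈ μ.support, 0 ≤ s z := by
  refine ⟨fun hs z => nonneg_of_mem_support hs, fun hs => ?_⟩
  refine isNonneg_sesqForm_iff_integral.2 fun p => integral_nonneg_of_ae ?_
  filter_upwards [Measure.support_mem_ae] with z hz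
  exact mul_nonneg (hs z hz) (sq_nonneg _)

lemma eq_zero_of_sesqForm_self_eq_zero (hμ : μ.support.Infinite)
    (hs : ∀ z ∈ μ.support, 0 ≤ s z) (hfin : {z | s z = 0}.Finite) {p : ℂ[X]}
    (h : sesqForm μ s p p = 0) : p = 0 := by
  rw [sesqForm_self, Complex.ofReal_eq_zero] at h
  have hcont : Continuous fun z : Circle => s z * ‖p.eval (z : ℂ)‖ ^ 2 :=
    s.continuous.mul ((continuous_eval_circle p).norm.pow 2)
  have isRoot_of_mem : ∀ z ∈ μ.support \ {z | s z = 0}, p.IsRoot (z : ℂ) := by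
    intro z hz
    have hzero := eq_zero_of_mem_support_of_integral_eq_zero hcont
      (integrable_of_continuous_circle μ hcont)
      (fun z hz => mul_nonneg (hs z hz) (sq_nonneg _)) h hz.1
    simpa using (mul_eq_zero.1 hzero).resolve_left hz.2
  refine eq_zero_of_infinite_isRoot p <|
    ((hμ.sdiff hfin).image Circle.coe_injective.injOn).mono ?_
  rintro _ ⟨z, hz, rfl⟩
  exact isRoot_of_mem z hz

lemma eq_zero_of_ip_self_eq_zero (hμ : μ.support.Infinite) {p : ℂ[X]} (h : ip μ p p = 0) :
    p = 0 :=
  eq_zero_of_sesqForm_self_eq_zero (s := 1) hμ (fun _ _ => zero_le_one) (by simp)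
    ((ip_eq_sesqForm μ p p).symm.trans h)

end Positivity

section MonicOPUC

variable (μ : Measure Circle)

lemma monicOPUC_eq_sub_sum (n : ℕ) : monicOPUC μ n = X ^ n - ∑ j : Fin n,
    (ip μ (X ^ n) (monicOPUC μ j) / ip μ (monicOPUC μ j) (monicOPUC μ j)) • monicOPUC μ j := by
  rw [monicOPUC]
  simp only [smul_eq_C_mul]

lemma monicOPUC_zero : monicOPUC μ 0 = 1 := by
  rw [monicOPUC_eq_sub_sum, Fin.sum_univ_zero, pow_zero, sub_zero]

lemma degree_monicOPUC (n : ℕ) : (monicOPUC μ n).degree = n := by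
  induction n using Nat.strong_induction_on with
  | _ n ih =>
    rw [monicOPUC_eq_sub_sum, degree_sub_eq_left_of_degree_lt, degree_X_pow]
    rw [degree_X_pow, ← mem_degreeLT]
    refine sum_mem fun j _ => Submodule.smul_mem _ _ (mem_degreeLT.2 ?_)
    rw [ih j j.2]
    exact_mod_cast j.2

/-- The monic orthogonal polynomials as a polynomial sequence in Mathlib's sense, which makes the
spanning properties of such sequences available. -/
noncomputable def opucSequence : Polynomial.Sequence ℂ where
  elems' := monicOPUC μ
  degree_eq' := degree_monicOPUC μ

lemma opucSequence_apply (n : ℕ) : opucSequence μ n = monicOPUC μ n := rfl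

lemma monicOPUC_mem_degreeLT {n m : ℕ} (h : n < m) : monicOPUC μ n ∈ degreeLT ℂ m :=
  mem_degreeLT.2 <| by rw [degree_monicOPUC]; exact_mod_cast h

lemma coeff_monicOPUC_self (n : ℕ) : (monicOPUC μ n).coeff n = 1 := by
  have hsum : (∑ j : Fin n, (ip μ (X ^ n) (monicOPUC μ j) /
      ip μ (monicOPUC μ j) (monicOPUC μ j)) • monicOPUC μ j) ∈ degreeLT ℂ n :=
    sum_mem fun j _ => Submodule.smul_mem _ _ (monicOPUC_mem_degreeLT μ j.2)
  rw [monicOPUC_eq_sub_sum, coeff_sub, coeff_X_pow_self,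
    coeff_eq_zero_of_mem_degreeLT hsum le_rfl, sub_zero]

lemma monicOPUC_ne_zero (n : ℕ) : monicOPUC μ n ≠ 0 :=
  (opucSequence μ).ne_zero n

/-- The squared norm `‖Φ_n‖²` in `L²(μ)`. -/
noncomputable def normSqOPUC (n : ℕ) : ℝ :=
  ∫ z : Circle, ‖(monicOPUC μ n).eval (z : ℂ)‖ ^ 2 ∂μ

variable {μ} [IsFiniteMeasure μ]

lemma ip_monicOPUC_self (n : ℕ) : ip μ (monicOPUC μ n) (monicOPUC μ n) = normSqOPUC μ n := by
  simp [ip_eq_sesqForm, sesqForm_self, normSqOPUC]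

lemma normSqOPUC_pos (hμ : μ.support.Infinite) (n : ℕ) : 0 < normSqOPUC μ n := by
  refine lt_of_le_of_ne (integral_nonneg fun z => sq_nonneg _) fun h => ?_
  refine monicOPUC_ne_zero μ n (eq_zero_of_ip_self_eq_zero hμ ?_)
  rw [ip_monicOPUC_self, ← h, Complex.ofReal_zero]

lemma normSqOPUC_ne_zero (hμ : μ.support.Infinite) (n : ℕ) : (normSqOPUC μ n : ℂ) ≠ 0 :=
  Complex.ofReal_ne_zero.2 (normSqOPUC_pos hμ n).ne'

lemma ip_monicOPUC_of_lt (hμ : μ.support.Infinite) {n m : ℕ} (hm : m < n) :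
    ip μ (monicOPUC μ n) (monicOPUC μ m) = 0 := by
  induction n using Nat.strong_induction_on generalizing m with
  | _ n ih =>
    have ip_of_ne (j : Fin n) (hj : (j : ℕ) ≠ m) :
        ip μ (monicOPUC μ j) (monicOPUC μ m) = 0 := by
      rcases lt_or_gt_of_ne hj with h | h
      · exact (ip_eq_zero_comm μ).1 (ih m hm h)
      · exact ih j j.2 h
    have hself : ip μ (monicOPUC μ m) (monicOPUC μ m) ≠ 0 := by
      rw [ip_monicOPUC_self]
      exact normSqOPUC_ne_zero hμ m
    rw [monicOPUC_eq_sub_sum, ip_eq_sesqForm, map_sub, map_sum]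
    simp only [map_smul, smul_eq_mul, ← ip_eq_sesqForm]
    rw [Finset.sum_eq_single_of_mem ⟨m, hm⟩ (Finset.mem_univ _), div_mul_cancel₀ _ hself, sub_self]
    exact fun j _ hj => by rw [ip_of_ne j fun h => hj (Fin.ext h), mul_zero]

lemma ip_monicOPUC_of_ne (hμ : μ.support.Infinite) {n m : ℕ} (h : n ≠ m) :
    ip μ (monicOPUC μ n) (monicOPUC μ m) = 0 := by
  rcases lt_or_gt_of_ne h with h | h
  · exact (ip_eq_zero_comm μ).1 (ip_monicOPUC_of_lt hμ h)
  · exact ip_monicOPUC_of_lt hμ h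

lemma ip_monicOPUC_right (hμ : μ.support.Infinite) {n : ℕ} {p : ℂ[X]}
    (hp : p ∈ degreeLT ℂ (n + 1)) : ip μ p (monicOPUC μ n) = p.coeff n * normSqOPUC μ n := by
  have eqOn := eqOn_degreeLT_of_sequence (opucSequence μ) (n := n + 1)
    (L₁ := sesqForm μ 1 (monicOPUC μ n)) (L₂ := (normSqOPUC μ n : ℂ) • lcoeff ℂ n) fun j hj => ?_
  · simpa [ip_eq_sesqForm, mul_comm] using eqOn hp
  · rw [opucSequence_apply, ← ip_eq_sesqForm, LinearMap.smul_apply, lcoeff_apply, smul_eq_mul]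
    rcases (Nat.lt_succ_iff.1 hj).eq_or_lt with rfl | hj
    · rw [ip_monicOPUC_self, coeff_monicOPUC_self, mul_one]
    · rw [ip_monicOPUC_of_ne hμ hj.ne,
        coeff_eq_zero_of_mem_degreeLT (monicOPUC_mem_degreeLT μ hj) le_rfl, mul_zero]

lemma ip_monicOPUC_left (hμ : μ.support.Infinite) {n : ℕ} {q : ℂ[X]}
    (hq : q ∈ degreeLT ℂ (n + 1)) :
    ip μ (monicOPUC μ n) q = conj (q.coeff n) * normSqOPUC μ n := by
  rw [← conj_ip, ip_monicOPUC_right hμ hq, map_mul, Complex.conj_ofReal]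

lemma ip_monicOPUC_left_eq_zero (hμ : μ.support.Infinite) {n : ℕ} {q : ℂ[X]}
    (hq : q ∈ degreeLT ℂ n) : ip μ (monicOPUC μ n) q = 0 := by
  rw [ip_monicOPUC_left hμ (degreeLT_mono n.le_succ hq), coeff_eq_zero_of_mem_degreeLT hq le_rfl,
    map_zero, zero_mul]

end MonicOPUC

section Szego

/-- The reversed polynomial `p^*(z) = z^n conj(p(1 / conj z))`. -/
noncomputable def starPoly (n : ℕ) (p : ℂ[X]) : ℂ[X] := (p.map (starRingEnd ℂ)).reflect n

lemma coeff_starPoly (n : ℕ) (p : ℂ[X]) (k : ℕ) :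
    (starPoly n p).coeff k = conj (p.coeff (revAt n k)) := by
  rw [starPoly, coeff_reflect, coeff_map]

variable {n : ℕ} {p q : ℂ[X]}

lemma starPoly_mem_degreeLT (hp : p ∈ degreeLT ℂ (n + 1)) : starPoly n p ∈ degreeLT ℂ (n + 1) :=
  mem_degreeLT_iff_coeff_eq_zero.2 fun m hm => by
    rw [coeff_starPoly, revAt_eq_self_of_lt hm, coeff_eq_zero_of_mem_degreeLT hp hm, map_zero]

lemma eval_starPoly (hp : p ∈ degreeLT ℂ (n + 1)) (z : Circle) :
    (starPoly n p).eval (z : ℂ) = (z : ℂ) ^ n * conj (p.eval (z : ℂ)) := by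
  let _ : Invertible (z : ℂ) := invertibleOfNonzero z.coe_ne_zero
  have hdeg : (starPoly n p).natDegree ≤ n := natDegree_le_iff_coeff_eq_zero.2 fun m hm =>
    coeff_eq_zero_of_mem_degreeLT (starPoly_mem_degreeLT hp) hm
  have h := eval₂_reflect_mul_pow (RingHom.id ℂ) (z : ℂ) n (starPoly n p) hdeg
  rw [starPoly, reflect_reflect, eval₂_id, eval₂_id, invOf_eq_inv, ← Circle.coe_inv,
    Circle.coe_inv_eq_conj, eval_map, eval₂_at_apply] at h
  rw [starPoly, ← h, mul_comm]

lemma ip_starPoly_left (μ : Measure Circle) (hp : p ∈ degreeLT ℂ (n + 1))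
    (hq : q ∈ degreeLT ℂ (n + 1)) : ip μ (starPoly n p) q = ip μ (starPoly n q) p := by
  rw [ip, ip]
  congr 1 with z
  rw [eval_starPoly hp, eval_starPoly hq]
  ring

/-- The reversed orthogonal polynomial `Φ_n^*`. -/
noncomputable def revOPUC (μ : Measure Circle) (n : ℕ) : ℂ[X] := starPoly n (monicOPUC μ n)

lemma revOPUC_mem_degreeLT (μ : Measure Circle) (n : ℕ) : revOPUC μ n ∈ degreeLT ℂ (n + 1) :=
  starPoly_mem_degreeLT (monicOPUC_mem_degreeLT μ n.lt_succ_self)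

lemma coeff_zero_revOPUC (μ : Measure Circle) (n : ℕ) : (revOPUC μ n).coeff 0 = 1 := by
  rw [revOPUC, coeff_starPoly, revAt_zero, coeff_monicOPUC_self, map_one]

lemma eval_revOPUC (μ : Measure Circle) (n : ℕ) (z : Circle) :
    (revOPUC μ n).eval (z : ℂ) = (z : ℂ) ^ n * conj ((monicOPUC μ n).eval (z : ℂ)) :=
  eval_starPoly (monicOPUC_mem_degreeLT μ n.lt_succ_self) z

variable {μ : Measure Circle} [IsFiniteMeasure μ]

lemma ip_revOPUC_left (hμ : μ.support.Infinite) (hq : q ∈ degreeLT ℂ (n + 1)) :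
    ip μ (revOPUC μ n) q = conj (q.coeff 0) * normSqOPUC μ n := by
  rw [revOPUC, ip_starPoly_left μ (monicOPUC_mem_degreeLT μ n.lt_succ_self) hq,
    ip_monicOPUC_right hμ (starPoly_mem_degreeLT hq), coeff_starPoly, revAt_le le_rfl, Nat.sub_self]

lemma coeff_zero_monicOPUC_succ (μ : Measure Circle) (n : ℕ) :
    (monicOPUC μ (n + 1)).coeff 0 = -conj (verblunsky μ n) := by
  rw [verblunsky, map_neg, Complex.conj_conj, neg_neg, coeff_zero_eq_eval_zero]

lemma monicOPUC_succ (hμ : μ.support.Infinite) (n : ℕ) : monicOPUC μ (n + 1) =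
    X * monicOPUC μ n - conj (verblunsky μ n) • revOPUC μ n := by
  -- The difference `f` of the two sides vanishes because it is orthogonal to each of its terms.
  set f := X * monicOPUC μ n - (1 : ℂ) • monicOPUC μ (n + 1) -
    conj (verblunsky μ n) • revOPUC μ n with hf
  have hmem : f ∈ degreeLT ℂ (n + 1) := by
    refine sub_mem (sub_smul_mem_degreeLT ?_ ?_ ?_)
      (Submodule.smul_mem _ _ (revOPUC_mem_degreeLT μ n))
    · exact X_mul_mem_degreeLT (monicOPUC_mem_degreeLT μ n.lt_succ_self)
    · exact monicOPUC_mem_degreeLT μ (n + 1).lt_succ_self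
    · rw [coeff_X_mul, coeff_monicOPUC_self, coeff_monicOPUC_self, one_mul]
  have hcoeff : f.coeff 0 = 0 := by
    simp only [hf, coeff_sub, coeff_X_mul_zero, coeff_smul, smul_eq_mul, coeff_zero_revOPUC,
      coeff_zero_monicOPUC_succ]
    ring
  obtain ⟨g, hg⟩ := X_dvd_iff.2 hcoeff
  have hgmem : g ∈ degreeLT ℂ n := mem_degreeLT_of_X_mul_mem (hg ▸ hmem)
  have orth_X_mul : ip μ (X * monicOPUC μ n) f = 0 := by
    rw [hg, ip_X_mul_X_mul, ip_monicOPUC_left_eq_zero hμ hgmem]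
  have orth_succ : ip μ (monicOPUC μ (n + 1)) f = 0 := ip_monicOPUC_left_eq_zero hμ hmem
  have orth_rev : ip μ (revOPUC μ n) f = 0 := by
    rw [ip_revOPUC_left hμ hmem, hcoeff, map_zero, zero_mul]
  have hself : ip μ f f = 0 := by
    simp only [ip_eq_sesqForm] at orth_X_mul orth_succ orth_rev ⊢
    nth_rewrite 2 [hf]
    simp only [map_sub, map_smul, orth_X_mul, orth_succ, orth_rev, smul_zero, sub_zero]
  have hf0 := eq_zero_of_ip_self_eq_zero hμ hself
  rw [hf, one_smul] at hf0
  linear_combination -hf0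

lemma normSqOPUC_succ (hμ : μ.support.Infinite) (n : ℕ) :
    normSqOPUC μ (n + 1) = (1 - ‖verblunsky μ n‖ ^ 2) * normSqOPUC μ n := by
  have orth_left : ip μ (monicOPUC μ (n + 1)) (revOPUC μ n) = 0 :=
    ip_monicOPUC_left_eq_zero hμ (revOPUC_mem_degreeLT μ n)
  have orth_right := (ip_eq_zero_comm μ).1 orth_left
  have norm_rev : ip μ (revOPUC μ n) (revOPUC μ n) = normSqOPUC μ n := by
    rw [ip_revOPUC_left hμ (revOPUC_mem_degreeLT μ n), coeff_zero_revOPUC, map_one, one_mul]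
  have norm_monic := ip_monicOPUC_self (μ := μ) (n + 1)
  have h := ip_X_mul_X_mul μ (monicOPUC μ n) (monicOPUC μ n)
  rw [ip_monicOPUC_self, eq_add_of_sub_eq (monicOPUC_succ hμ n).symm] at h
  simp only [ip_eq_sesqForm] at h orth_left orth_right norm_rev norm_monic
  simp only [map_add, LinearMap.add_apply, map_smulₛₗ, LinearMap.smul_apply, smul_eq_mul,
    RingHom.id_apply, orth_left, orth_right, norm_rev, norm_monic, Complex.conj_conj] at h
  have hα := Complex.conj_mul' (verblunsky μ n)
  apply Complex.ofReal_injective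
  push_cast
  linear_combination h - (normSqOPUC μ n : ℂ) * hα

lemma norm_verblunsky_lt_one (hμ : μ.support.Infinite) (n : ℕ) : ‖verblunsky μ n‖ < 1 := by
  have h : 0 < 1 - ‖verblunsky μ n‖ ^ 2 :=
    pos_of_mul_pos_left (normSqOPUC_succ hμ n ▸ normSqOPUC_pos hμ (n + 1)) (normSqOPUC_pos hμ n).le
  exact (sq_lt_one_iff₀ (norm_nonneg _)).1 (by linarith)

lemma eval_monicOPUC_succ (hμ : μ.support.Infinite) (n : ℕ) (z : ℂ) :
    (monicOPUC μ (n + 1)).eval z =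
      z * (monicOPUC μ n).eval z - conj (verblunsky μ n) * (revOPUC μ n).eval z := by
  rw [monicOPUC_succ hμ, eval_sub, eval_mul, eval_X, eval_smul, smul_eq_mul]

lemma conj_eval_monicOPUC_succ (hμ : μ.support.Infinite) (n : ℕ) (z : ℂ) :
    conj ((monicOPUC μ (n + 1)).eval z) = conj z * conj ((monicOPUC μ n).eval z) -
      verblunsky μ n * conj ((revOPUC μ n).eval z) := by
  rw [eval_monicOPUC_succ hμ, map_sub, map_mul, map_mul, Complex.conj_conj]

lemma eval_revOPUC_succ (hμ : μ.support.Infinite) (n : ℕ) (z : Circle) :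
    (revOPUC μ (n + 1)).eval (z : ℂ) = (revOPUC μ n).eval (z : ℂ) -
      verblunsky μ n * (z * (monicOPUC μ n).eval (z : ℂ)) := by
  have hz : (z : ℂ) ^ n * conj (z : ℂ) ^ n = 1 := by rw [← mul_pow, circle_mul_conj, one_pow]
  rw [eval_revOPUC, conj_eval_monicOPUC_succ hμ, eval_revOPUC, map_mul, map_pow, Complex.conj_conj]
  linear_combination (z : ℂ) ^ n * conj ((monicOPUC μ n).eval (z : ℂ)) * circle_mul_conj z -
    verblunsky μ n * z * (monicOPUC μ n).eval (z : ℂ) * hz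

end Szego

section Kernel

variable (μ : Measure Circle)

/-- The Christoffel–Darboux kernel `K_n(·, w) = ∑_{j < n} Φ_j conj(Φ_j(w)) / ‖Φ_j‖²`, reproducing
evaluation at `w` on polynomials of degree less than `n`. -/
noncomputable def cdKernel (w : ℂ) (n : ℕ) : ℂ[X] :=
  ∑ j ∈ Finset.range n, (conj ((monicOPUC μ j).eval w) / normSqOPUC μ j) • monicOPUC μ j

lemma cdKernel_zero (w : ℂ) : cdKernel μ w 0 = 0 := Finset.sum_range_zero _

lemma cdKernel_succ (w : ℂ) (n : ℕ) : cdKernel μ w (n + 1) = cdKernel μ w n +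
    (conj ((monicOPUC μ n).eval w) / normSqOPUC μ n) • monicOPUC μ n :=
  Finset.sum_range_succ _ _

lemma cdKernel_one (w : ℂ) : cdKernel μ w 1 = C (1 / (normSqOPUC μ 0 : ℂ)) := by
  rw [cdKernel_succ, cdKernel_zero, monicOPUC_zero, zero_add, eval_one, map_one, smul_eq_C_mul,
    mul_one]

lemma cdKernel_mem_degreeLT (w : ℂ) (n : ℕ) : cdKernel μ w n ∈ degreeLT ℂ n :=
  sum_mem fun _ hj => Submodule.smul_mem _ _ (monicOPUC_mem_degreeLT μ (Finset.mem_range.1 hj))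

variable {μ} [IsFiniteMeasure μ]

lemma ip_cdKernel_right (hμ : μ.support.Infinite) (w : ℂ) {n : ℕ} {p : ℂ[X]}
    (hp : p ∈ degreeLT ℂ n) : ip μ p (cdKernel μ w n) = p.eval w := by
  refine eqOn_degreeLT_of_sequence (opucSequence μ) (L₁ := sesqForm μ 1 (cdKernel μ w n))
    (L₂ := leval w) (fun j hj => ?_) hp |> (ip_eq_sesqForm μ _ _).trans
  rw [cdKernel, map_sum, LinearMap.sum_apply, opucSequence_apply, leval_apply]
  simp only [map_smulₛₗ, LinearMap.smul_apply, smul_eq_mul, ← ip_eq_sesqForm]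
  rw [Finset.sum_eq_single_of_mem j (Finset.mem_range.2 hj), ip_monicOPUC_self, map_div₀,
    Complex.conj_conj, Complex.conj_ofReal, div_mul_cancel₀ _ (normSqOPUC_ne_zero hμ j)]
  exact fun i _ hi => by rw [ip_monicOPUC_of_ne hμ hi.symm, mul_zero]

lemma normSqOPUC_mul_eval_cdKernel_succ (hμ : μ.support.Infinite) (z w : ℂ) (n : ℕ) :
    normSqOPUC μ n * (cdKernel μ w (n + 1)).eval z = normSqOPUC μ n * (cdKernel μ w n).eval z +
      (monicOPUC μ n).eval z * conj ((monicOPUC μ n).eval w) := by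
  rw [cdKernel_succ, eval_add, eval_smul, smul_eq_mul, mul_add, ← mul_assoc,
    mul_div_cancel₀ _ (normSqOPUC_ne_zero hμ n), mul_comm (conj _)]

theorem christoffel_darboux (hμ : μ.support.Infinite) (z w : Circle) (n : ℕ) :
    (1 - (z : ℂ) * conj (w : ℂ)) * (normSqOPUC μ n * (cdKernel μ w n).eval (z : ℂ)) =
      (revOPUC μ n).eval (z : ℂ) * conj ((revOPUC μ n).eval (w : ℂ)) -
        (monicOPUC μ n).eval (z : ℂ) * conj ((monicOPUC μ n).eval (w : ℂ)) := by
  induction n with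
  | zero => simp [cdKernel_zero, eval_revOPUC, monicOPUC_zero]
  | succ n ih =>
    have hα := Complex.mul_conj' (verblunsky μ n)
    have hadd := normSqOPUC_mul_eval_cdKernel_succ hμ z w n
    rw [normSqOPUC_succ hμ, eval_monicOPUC_succ hμ, conj_eval_monicOPUC_succ hμ,
      eval_revOPUC_succ hμ, eval_revOPUC_succ hμ]
    simp only [map_sub, map_mul]
    push_cast
    linear_combination (1 - (z : ℂ) * conj (w : ℂ)) * (1 - (‖verblunsky μ n‖ : ℂ) ^ 2) * hadd +
      (1 - (‖verblunsky μ n‖ : ℂ) ^ 2) * ih + ((revOPUC μ n).eval (z : ℂ) *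
        conj ((revOPUC μ n).eval (w : ℂ)) - z * conj (w : ℂ) * ((monicOPUC μ n).eval (z : ℂ) *
        conj ((monicOPUC μ n).eval (w : ℂ)))) * hα

theorem christoffel_darboux_succ (hμ : μ.support.Infinite) (z w : Circle) (n : ℕ) :
    (1 - (z : ℂ) * conj (w : ℂ)) * (normSqOPUC μ n * (cdKernel μ w (n + 1)).eval (z : ℂ)) =
      (revOPUC μ n).eval (z : ℂ) * conj ((revOPUC μ n).eval (w : ℂ)) -
        z * conj (w : ℂ) * ((monicOPUC μ n).eval (z : ℂ) *
          conj ((monicOPUC μ n).eval (w : ℂ))) := by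
  linear_combination (1 - (z : ℂ) * conj (w : ℂ)) * normSqOPUC_mul_eval_cdKernel_succ hμ z w n +
    christoffel_darboux hμ z w n

end Kernel

section Christoffel

variable (μ : Measure Circle)

/-- Christoffel's formula for the `n`-th orthogonal polynomial of the form
`(q, p) ↦ ⟨(z - z₁) p, (z - w) q⟩`. The numerator vanishes at `z₁`, so that the division is exact,
and the leading coefficient is `K_{n+1}(z₁, w)` rather than `1`, which avoids a case distinction. -/
noncomputable def christoffelPoly (z₁ w : ℂ) (n : ℕ) : ℂ[X] :=
  ((cdKernel μ w (n + 1)).eval z₁ • monicOPUC μ (n + 1) -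
    (monicOPUC μ (n + 1)).eval z₁ • cdKernel μ w (n + 1)) /ₘ (X - C z₁)

variable (z₁ w : ℂ) (n : ℕ)

lemma X_sub_C_mul_christoffelPoly : (X - C z₁) * christoffelPoly μ z₁ w n =
    (cdKernel μ w (n + 1)).eval z₁ • monicOPUC μ (n + 1) -
      (monicOPUC μ (n + 1)).eval z₁ • cdKernel μ w (n + 1) := by
  refine mul_divByMonic_eq_iff_isRoot.2 ?_
  simp only [IsRoot, eval_sub, eval_smul, smul_eq_mul]
  ring

lemma X_sub_C_mul_christoffelPoly_mem_degreeLT :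
    (X - C z₁) * christoffelPoly μ z₁ w n ∈ degreeLT ℂ (n + 2) := by
  rw [X_sub_C_mul_christoffelPoly]
  exact sub_mem (Submodule.smul_mem _ _ (monicOPUC_mem_degreeLT μ (n + 1).lt_succ_self))
    (Submodule.smul_mem _ _ (degreeLT_mono (n + 1).le_succ (cdKernel_mem_degreeLT μ w _)))

lemma christoffelPoly_mem_degreeLT : christoffelPoly μ z₁ w n ∈ degreeLT ℂ (n + 1) :=
  mem_degreeLT_of_X_sub_C_mul_mem (X_sub_C_mul_christoffelPoly_mem_degreeLT μ z₁ w n)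

lemma coeff_christoffelPoly : (christoffelPoly μ z₁ w n).coeff n =
    (cdKernel μ w (n + 1)).eval z₁ := by
  rw [← coeff_X_sub_C_mul_of_mem_degreeLT z₁ (christoffelPoly_mem_degreeLT μ z₁ w n),
    X_sub_C_mul_christoffelPoly, coeff_sub, coeff_smul, coeff_smul, coeff_monicOPUC_self,
    coeff_eq_zero_of_mem_degreeLT (cdKernel_mem_degreeLT μ w _) le_rfl, smul_zero, sub_zero,
    smul_eq_mul, mul_one]

variable {μ} [IsFiniteMeasure μ] {n}

lemma ip_X_sub_C_mul_christoffelPoly (hμ : μ.support.Infinite) {q : ℂ[X]}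
    (hq : q ∈ degreeLT ℂ (n + 1)) :
    ip μ ((X - C z₁) * christoffelPoly μ z₁ w n) ((X - C w) * q) =
      (cdKernel μ w (n + 2)).eval z₁ * (conj (q.coeff n) * normSqOPUC μ (n + 1)) := by
  have hmem : (X - C w) * q ∈ degreeLT ℂ (n + 2) := X_sub_C_mul_mem_degreeLT w hq
  have orth_kernel : ip μ (cdKernel μ w (n + 2)) ((X - C w) * q) = 0 := by
    rw [ip_eq_zero_comm, ip_cdKernel_right hμ w hmem]
    simp
  have ip_monic := ip_monicOPUC_left hμ hmem
  rw [coeff_X_sub_C_mul_of_mem_degreeLT w hq] at ip_monic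
  have numerator : (X - C z₁) * christoffelPoly μ z₁ w n =
      (cdKernel μ w (n + 2)).eval z₁ • monicOPUC μ (n + 1) -
        (monicOPUC μ (n + 1)).eval z₁ • cdKernel μ w (n + 2) := by
    rw [X_sub_C_mul_christoffelPoly, cdKernel_succ μ w (n + 1), eval_add, eval_smul, smul_eq_mul]
    module
  rw [numerator, ip_eq_sesqForm, map_sub, map_smul, map_smul, ← ip_eq_sesqForm, ← ip_eq_sesqForm,
    orth_kernel, ip_monic, smul_zero, sub_zero, smul_eq_mul]

end Christoffel

section ChainSequence

variable {K : Type*} [Field K] {G y V m : ℕ → K}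

/-- The ratio of the left-hand side of the recurrence
`(1 - G n) V (n + 2) = y n V (n + 1) - G n V n` to the term `y n V (n + 1)`; the chain sequence
`(1 - G n) G (n + 1) / (y n y (n + 1))` has the parameters `1 - chainRatio G y V n`. -/
def chainRatio (G y V : ℕ → K) (n : ℕ) : K :=
  (1 - G n) * V (n + 2) / (y n * V (n + 1))

lemma chainRatio_zero (hV : (1 - G 0) * V 2 = y 0 * V 1 - G 0 * V 0) (hV₀ : V 0 = 0)
    (hV₁ : V 1 ≠ 0) (hy : y 0 ≠ 0) : chainRatio G y V 0 = 1 := by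
  rw [chainRatio, hV, hV₀, mul_zero, sub_zero, div_self (mul_ne_zero hy hV₁)]

lemma chainRatio_succ {n : ℕ} (hV : (1 - G (n + 1)) * V (n + 3) =
      y (n + 1) * V (n + 2) - G (n + 1) * V (n + 1)) (hG : G n ≠ 1) (hV₂ : V (n + 2) ≠ 0)
    (hy₀ : y n ≠ 0) (hy₁ : y (n + 1) ≠ 0) :
    chainRatio G y V (n + 1) =
      1 - (1 - G n) * G (n + 1) / (y n * y (n + 1)) / chainRatio G y V n := by
  have hG' : 1 - G n ≠ 0 := sub_ne_zero.2 hG.symm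
  rw [chainRatio, chainRatio, hV]
  field_simp

variable [LinearOrder K] [IsStrictOrderedRing K]

lemma chainRatio_pos_iff {n : ℕ} (hG : G n < 1) (hy : y n < 0) :
    0 < chainRatio G y V n ↔ V (n + 1) * V (n + 2) < 0 := by
  rw [chainRatio, mul_div_mul_comm, ← smul_eq_mul,
    smul_pos_iff_of_neg_left (div_neg_of_pos_of_neg (sub_pos.2 hG) hy), div_neg_iff, mul_neg_iff,
    or_comm, and_comm, and_comm (a := 0 < V (n + 2))]

lemma neg_of_alternating (hG : ∀ n, 0 < G n ∧ G n < 1)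
    (hV : ∀ n, (1 - G n) * V (n + 2) = y n * V (n + 1) - G n * V n) (hV₀ : V 0 = 0)
    (halt : ∀ n, V (n + 1) * V (n + 2) < 0) (n : ℕ) : y n < 0 := by
  have hprev : V n * V (n + 1) ≤ 0 := by
    cases n with
    | zero => rw [hV₀, zero_mul]
    | succ n => exact (halt n).le
  have hmul : y n * V (n + 1) ^ 2 =
      (1 - G n) * (V (n + 1) * V (n + 2)) + G n * (V n * V (n + 1)) := by
    linear_combination (-V (n + 1)) * hV n
  refine neg_of_mul_neg_left (b := V (n + 1) ^ 2) ?_ (sq_nonneg _)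
  rw [hmul]
  exact add_neg_of_neg_of_nonpos (mul_neg_of_pos_of_neg (sub_pos.2 (hG n).2) (halt n))
    (mul_nonpos_of_nonneg_of_nonpos (hG n).1.le hprev)

lemma one_sub_eq_chainRatio_of_alternating (hG : ∀ n, 0 < G n ∧ G n < 1)
    (hV : ∀ n, (1 - G n) * V (n + 2) = y n * V (n + 1) - G n * V n) (hV₀ : V 0 = 0)
    (hm₀ : m 0 = 0)
    (hm : ∀ n, m (n + 1) = (1 - G n) * G (n + 1) / (y n * y (n + 1)) / (1 - m n))
    (halt : ∀ n, V (n + 1) * V (n + 2) < 0) (n : ℕ) : 1 - m n = chainRatio G y V n := by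
  have hy := neg_of_alternating hG hV hV₀ halt
  have hV_ne : ∀ n, V (n + 1) ≠ 0 := fun n => left_ne_zero_of_mul (halt n).ne
  induction n with
  | zero => rw [hm₀, sub_zero, chainRatio_zero (hV 0) hV₀ (hV_ne 0) (hy 0).ne]
  | succ n ih =>
    rw [hm, ih, chainRatio_succ (hV (n + 1)) (hG n).2.ne (hV_ne (n + 1)) (hy n).ne
      (hy (n + 1)).ne]

lemma neg_and_alternating_and_one_sub_eq_chainRatio (hG : ∀ n, 0 < G n ∧ G n < 1)
    (hV : ∀ n, (1 - G n) * V (n + 2) = y n * V (n + 1) - G n * V n) (hV₀ : V 0 = 0)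
    (hV₁ : V 1 ≠ 0) (hm₀ : m 0 = 0)
    (hm : ∀ n, m (n + 1) = (1 - G n) * G (n + 1) / (y n * y (n + 1)) / (1 - m n))
    (hy₀ : y 0 < 0) (hm_mem : ∀ n, 0 < m (n + 1) ∧ m (n + 1) < 1) (n : ℕ) :
    y n < 0 ∧ V (n + 1) * V (n + 2) < 0 ∧ 1 - m n = chainRatio G y V n := by
  induction n with
  | zero =>
    have hratio := chainRatio_zero (hV 0) hV₀ hV₁ hy₀.ne
    refine ⟨hy₀, (chainRatio_pos_iff (hG 0).2 hy₀).1 (hratio ▸ one_pos), ?_⟩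
    rw [hm₀, sub_zero, hratio]
  | succ n ih =>
    obtain ⟨hy, hVV, hmn⟩ := ih
    have one_sub_pos : 0 < 1 - m n := hmn ▸ (chainRatio_pos_iff (hG n).2 hy).2 hVV
    have hyy : 0 < y n * y (n + 1) := by
      have := hm n ▸ (hm_mem n).1
      rwa [div_pos_iff_of_pos_right one_sub_pos,
        div_pos_iff_of_pos_left (mul_pos (sub_pos.2 (hG n).2) (hG (n + 1)).1)] at this
    have hy' : y (n + 1) < 0 := (smul_pos_iff_of_neg_left hy).1 hyy
    have hmn' : 1 - m (n + 1) = chainRatio G y V (n + 1) := by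
      rw [hm, hmn, chainRatio_succ (hV (n + 1)) (hG n).2.ne
        (right_ne_zero_of_mul hVV.ne) hy.ne hy'.ne]
    refine ⟨hy', (chainRatio_pos_iff (hG (n + 1)).2 hy').1 ?_, hmn'⟩
    rw [← hmn', sub_pos]
    exact (hm_mem n).2

theorem alternating_iff_chain_parameters (hG : ∀ n, 0 < G n ∧ G n < 1)
    (hV : ∀ n, (1 - G n) * V (n + 2) = y n * V (n + 1) - G n * V n) (hV₀ : V 0 = 0)
    (hV₁ : V 1 ≠ 0) (hm₀ : m 0 = 0)
    (hm : ∀ n, m (n + 1) = (1 - G n) * G (n + 1) / (y n * y (n + 1)) / (1 - m n)) :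
    (∀ n, V (n + 1) * V (n + 2) < 0) ↔ y 0 < 0 ∧ ∀ n, 0 < m (n + 1) ∧ m (n + 1) < 1 := by
  refine ⟨fun halt => ?_, fun ⟨hy₀, hm_mem⟩ n =>
    (neg_and_alternating_and_one_sub_eq_chainRatio hG hV hV₀ hV₁ hm₀ hm hy₀ hm_mem n).2.1⟩
  have hy := neg_of_alternating hG hV hV₀ halt
  have one_sub_pos : ∀ n, 0 < 1 - m n := fun n => by
    rw [one_sub_eq_chainRatio_of_alternating hG hV hV₀ hm₀ hm halt]
    exact (chainRatio_pos_iff (hG n).2 (hy n)).2 (halt n)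
  refine ⟨hy 0, fun n => ⟨?_, sub_pos.1 (one_sub_pos (n + 1))⟩⟩
  rw [hm]
  exact div_pos (div_pos (mul_pos (sub_pos.2 (hG n).2) (hG (n + 1)).1)
    (mul_pos_of_neg_of_neg (hy n) (hy (n + 1)))) (one_sub_pos n)

end ChainSequence

section Tau

variable {α : ℕ → ℂ} (hα : ∀ n, ‖α n‖ < 1) (ϑ : ℝ) (n : ℕ)

lemma coe_circle_exp : ((Circle.exp ϑ : Circle) : ℂ) = Complex.exp (Complex.I * ϑ) := by
  rw [Circle.coe_exp, mul_comm]

lemma tau_zero (α : ℕ → ℂ) : tau α ϑ 0 = Circle.exp ϑ := by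
  rw [tau, coe_circle_exp]

lemma one_sub_mul_tau_succ (h : 1 - tau α ϑ n * α n ≠ 0) :
    (1 - tau α ϑ n * α n) * tau α ϑ (n + 1) =
      Circle.exp ϑ * tau α ϑ n * conj (1 - tau α ϑ n * α n) := by
  rw [tau, coe_circle_exp, map_sub, map_one]
  field_simp

include hα

lemma norm_tau : ‖tau α ϑ n‖ = 1 := by
  induction n with
  | zero => rw [tau_zero, Circle.norm_coe]
  | succ n ih =>
    have hlt : ‖tau α ϑ n * α n‖ < 1 := by rw [norm_mul, ih, one_mul]; exact hα n
    have hne := (isUnit_one_sub_of_norm_lt_one hlt).ne_zero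
    have h := congrArg norm (one_sub_mul_tau_succ ϑ n hne)
    rwa [norm_mul, norm_mul, norm_mul, Circle.norm_coe, ih, Complex.norm_conj, one_mul, one_mul,
      mul_eq_left₀ (norm_ne_zero_iff.2 hne)] at h

lemma norm_tau_mul_lt_one : ‖tau α ϑ n * α n‖ < 1 := by
  rw [norm_mul, norm_tau hα, one_mul]
  exact hα n

lemma one_sub_tau_mul_ne_zero : 1 - tau α ϑ n * α n ≠ 0 :=
  (isUnit_one_sub_of_norm_lt_one (norm_tau_mul_lt_one hα ϑ n)).ne_zero

lemma tau_mul_conj_tau : tau α ϑ n * conj (tau α ϑ n) = 1 := by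
  rw [Complex.mul_conj', norm_tau hα, Complex.ofReal_one, one_pow]

end Tau

section Recurrence

variable {μ : Measure Circle} [IsFiniteMeasure μ] (hμ : μ.support.Infinite) (ϑ : ℝ) (n : ℕ)
include hμ

lemma tau_mul_eval_revOPUC : tau (verblunsky μ) ϑ n * (revOPUC μ n).eval (Circle.exp ϑ : ℂ) =
    Circle.exp ϑ * (monicOPUC μ n).eval (Circle.exp ϑ : ℂ) := by
  have hα := norm_verblunsky_lt_one hμ
  induction n with
  | zero => rw [tau_zero, eval_revOPUC, monicOPUC_zero, eval_one, pow_zero, map_one, mul_one]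
  | succ n ih =>
    rw [eval_revOPUC_succ hμ, eval_monicOPUC_succ hμ]
    have hsucc := one_sub_mul_tau_succ ϑ n (one_sub_tau_mul_ne_zero hα ϑ n)
    rw [map_sub, map_one, map_mul] at hsucc
    linear_combination (revOPUC μ n).eval (Circle.exp ϑ : ℂ) * hsucc +
      (verblunsky μ n * tau (verblunsky μ) ϑ (n + 1) + Circle.exp ϑ) * ih -
      Circle.exp ϑ * conj (verblunsky μ n) * (revOPUC μ n).eval (Circle.exp ϑ : ℂ) *
        tau_mul_conj_tau hα ϑ n

lemma eval_revOPUC_succ_circle_exp : (revOPUC μ (n + 1)).eval (Circle.exp ϑ : ℂ) =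
    (1 - tau (verblunsky μ) ϑ n * verblunsky μ n) *
      (revOPUC μ n).eval (Circle.exp ϑ : ℂ) := by
  rw [eval_revOPUC_succ hμ, ← tau_mul_eval_revOPUC hμ]
  ring

lemma conj_eval_monicOPUC_circle_exp : conj ((monicOPUC μ n).eval (Circle.exp ϑ : ℂ)) =
    Circle.exp ϑ * conj (tau (verblunsky μ) ϑ n) *
      conj ((revOPUC μ n).eval (Circle.exp ϑ : ℂ)) := by
  have h := congrArg conj (tau_mul_eval_revOPUC hμ ϑ n)
  rw [map_mul, map_mul] at h
  linear_combination (-(Circle.exp ϑ : ℂ)) * h -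
    conj ((monicOPUC μ n).eval (Circle.exp ϑ : ℂ)) * circle_mul_conj (Circle.exp ϑ)

lemma christoffel_darboux_circle_exp (z : Circle) :
    (1 - (z : ℂ) * conj (Circle.exp ϑ : ℂ)) *
        (normSqOPUC μ n * (cdKernel μ (Circle.exp ϑ) n).eval (z : ℂ)) =
      conj ((revOPUC μ n).eval (Circle.exp ϑ : ℂ)) * ((revOPUC μ n).eval (z : ℂ) -
        Circle.exp ϑ * conj (tau (verblunsky μ) ϑ n) * (monicOPUC μ n).eval (z : ℂ)) := by
  rw [christoffel_darboux hμ, conj_eval_monicOPUC_circle_exp hμ]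
  ring

lemma christoffel_darboux_succ_circle_exp (z : Circle) :
    (1 - (z : ℂ) * conj (Circle.exp ϑ : ℂ)) *
        (normSqOPUC μ n * (cdKernel μ (Circle.exp ϑ) (n + 1)).eval (z : ℂ)) =
      conj ((revOPUC μ n).eval (Circle.exp ϑ : ℂ)) * ((revOPUC μ n).eval (z : ℂ) -
        z * conj (tau (verblunsky μ) ϑ n) * (monicOPUC μ n).eval (z : ℂ)) := by
  rw [christoffel_darboux_succ hμ, conj_eval_monicOPUC_circle_exp hμ]
  linear_combination (-(z : ℂ) * (monicOPUC μ n).eval (z : ℂ) *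
    conj (tau (verblunsky μ) ϑ n) * conj ((revOPUC μ n).eval (Circle.exp ϑ : ℂ))) *
      circle_mul_conj (Circle.exp ϑ)

lemma christoffel_darboux_add_two_circle_exp (z : Circle) {a ζ : ℂ}
    (ha : a = tau (verblunsky μ) ϑ n * verblunsky μ n) (hζ : ζ = z * conj (Circle.exp ϑ : ℂ)) :
    (1 - ζ) * ((1 - a * conj a) * normSqOPUC μ n *
        (cdKernel μ (Circle.exp ϑ) (n + 2)).eval (z : ℂ)) =
      conj ((revOPUC μ n).eval (Circle.exp ϑ : ℂ)) *
        ((1 - conj a) * ((revOPUC μ n).eval (z : ℂ) -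
            a * (z * conj (tau (verblunsky μ) ϑ n) * (monicOPUC μ n).eval (z : ℂ))) -
          ζ * (1 - a) * (z * conj (tau (verblunsky μ) ϑ n) * (monicOPUC μ n).eval (z : ℂ) -
            conj a * (revOPUC μ n).eval (z : ℂ))) := by
  have hα := norm_verblunsky_lt_one hμ
  have normSq_succ : (normSqOPUC μ (n + 1) : ℂ) = (1 - a * conj a) * normSqOPUC μ n := by
    rw [normSqOPUC_succ hμ, Complex.mul_conj', ha, norm_mul, norm_tau hα, one_mul]
    push_cast
    ring
  have tau_succ : (1 - conj a) * conj (tau (verblunsky μ) ϑ (n + 1)) =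
      conj (Circle.exp ϑ : ℂ) * conj (tau (verblunsky μ) ϑ n) * (1 - a) := by
    have h := congrArg conj (one_sub_mul_tau_succ ϑ n (one_sub_tau_mul_ne_zero hα ϑ n))
    simpa only [← ha, map_mul, map_sub, map_one, Complex.conj_conj] using h
  have hCD := christoffel_darboux_succ_circle_exp hμ ϑ (n + 1) z
  rw [eval_revOPUC_succ_circle_exp hμ, ← ha, eval_revOPUC_succ hμ, eval_monicOPUC_succ hμ,
    normSq_succ, ← hζ, map_mul, map_sub, map_one] at hCD
  rw [hCD]
  have hτ := tau_mul_conj_tau hα ϑ n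
  have hconj : conj a = conj (tau (verblunsky μ) ϑ n) * conj (verblunsky μ n) := by
    rw [ha, map_mul]
  linear_combination (-conj ((revOPUC μ n).eval (Circle.exp ϑ : ℂ)) * z *
      (z * (monicOPUC μ n).eval (z : ℂ) -
        conj (verblunsky μ n) * (revOPUC μ n).eval (z : ℂ))) * tau_succ +
    conj ((revOPUC μ n).eval (Circle.exp ϑ : ℂ)) * ((1 - conj a) * z *
      (monicOPUC μ n).eval (z : ℂ) *
        (verblunsky μ n * hτ + conj (tau (verblunsky μ) ϑ n) * ha) -
      ζ * (1 - a) * (revOPUC μ n).eval (z : ℂ) * hconj +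
      (1 - a) * conj (tau (verblunsky μ) ϑ n) * (z * (monicOPUC μ n).eval (z : ℂ) -
        conj (verblunsky μ n) * (revOPUC μ n).eval (z : ℂ)) * hζ)

lemma cdKernel_recurrence {z : Circle} (hz : z ≠ Circle.exp ϑ) {a ζ : ℂ}
    (ha : a = tau (verblunsky μ) ϑ n * verblunsky μ n) (hζ : ζ = z * conj (Circle.exp ϑ : ℂ)) :
    (1 - a * conj a) * (cdKernel μ (Circle.exp ϑ) (n + 2)).eval (z : ℂ) =
      ((1 - a) * ζ + (1 - conj a)) * (cdKernel μ (Circle.exp ϑ) (n + 1)).eval (z : ℂ) -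
        (1 - a) * (1 - conj a) * ζ * (cdKernel μ (Circle.exp ϑ) n).eval (z : ℂ) := by
  have hζ_ne : 1 - ζ ≠ 0 := by
    intro h
    refine hz (Circle.ext ?_)
    linear_combination (-(Circle.exp ϑ : ℂ)) * h - (Circle.exp ϑ : ℂ) * hζ -
      (z : ℂ) * circle_mul_conj (Circle.exp ϑ)
  have hζw : ζ * Circle.exp ϑ = z := by
    rw [hζ]
    linear_combination (z : ℂ) * circle_mul_conj (Circle.exp ϑ)
  -- Multiplied by `(1 - ζ) ‖Φ_n‖²`, each kernel is a combination of `Φ_n(z)` and `Φ_n^*(z)`.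
  have h₀ := christoffel_darboux_circle_exp hμ ϑ n z
  have h₁ := christoffel_darboux_succ_circle_exp hμ ϑ n z
  have h₂ := christoffel_darboux_add_two_circle_exp hμ ϑ n z ha hζ
  rw [← hζ] at h₀ h₁
  refine mul_left_cancel₀ (mul_ne_zero hζ_ne (normSqOPUC_ne_zero hμ n)) ?_
  linear_combination h₂ - ((1 - a) * ζ + (1 - conj a)) * h₁ + (1 - a) * (1 - conj a) * ζ * h₀ -
    (1 - a) * (1 - conj a) * conj ((revOPUC μ n).eval (Circle.exp ϑ : ℂ)) *
      conj (tau (verblunsky μ) ϑ n) * (monicOPUC μ n).eval (z : ℂ) * hζw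

end Recurrence

section Coefficients

variable {α : ℕ → ℂ} (hα : ∀ n, ‖α n‖ < 1) (ϑ : ℝ) (n : ℕ)
include hα

lemma one_sub_re_tau_mul_pos : 0 < 1 - (tau α ϑ n * α n).re :=
  sub_pos.2 ((Complex.re_le_norm _).trans_lt (norm_tau_mul_lt_one hα ϑ n))

lemma two_mul_one_sub_re_mul_gCoeff :
    2 * (1 - (tau α ϑ n * α n).re) * gCoeff α ϑ (n + 1) = ‖1 - tau α ϑ n * α n‖ ^ 2 := by
  have hne := (one_sub_re_tau_mul_pos hα ϑ n).ne'
  rw [gCoeff, Nat.add_sub_cancel]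
  field_simp

lemma two_mul_one_sub_re_mul_one_sub_gCoeff :
    2 * (1 - (tau α ϑ n * α n).re) * (1 - gCoeff α ϑ (n + 1)) = 1 - ‖tau α ϑ n * α n‖ ^ 2 := by
  rw [mul_sub, two_mul_one_sub_re_mul_gCoeff hα, ← Complex.normSq_eq_norm_sq, Complex.normSq_sub,
    Complex.normSq_one, Complex.normSq_eq_norm_sq, one_mul, Complex.conj_re]
  ring

lemma gCoeff_succ_pos : 0 < gCoeff α ϑ (n + 1) := by
  rw [← mul_pos_iff_of_pos_left (mul_pos two_pos (one_sub_re_tau_mul_pos hα ϑ n)),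
    two_mul_one_sub_re_mul_gCoeff hα]
  exact pow_pos (norm_pos_iff.2 (one_sub_tau_mul_ne_zero hα ϑ n)) 2

lemma gCoeff_succ_lt_one : gCoeff α ϑ (n + 1) < 1 := by
  rw [← sub_pos, ← mul_pos_iff_of_pos_left (mul_pos two_pos (one_sub_re_tau_mul_pos hα ϑ n)),
    two_mul_one_sub_re_mul_one_sub_gCoeff hα, sub_pos, sq_lt_one_iff₀ (norm_nonneg _)]
  exact norm_tau_mul_lt_one hα ϑ n

lemma two_mul_one_sub_re_mul_cos_sub (φ : ℝ) :
    ((2 * (1 - (tau α ϑ n * α n).re) : ℝ) : ℂ) *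
        ((Real.cos φ - cCoeff α ϑ (n + 1) * Real.sin φ : ℝ) : ℂ) =
      (1 - tau α ϑ n * α n) * Circle.exp φ +
        (1 - conj (tau α ϑ n * α n)) * conj (Circle.exp φ : ℂ) := by
  have hne := (one_sub_re_tau_mul_pos hα ϑ n).ne'
  have re_eq : ((1 - tau α ϑ n * α n) * Circle.exp φ).re =
      (1 - (tau α ϑ n * α n).re) * (Real.cos φ - cCoeff α ϑ (n + 1) * Real.sin φ) := by
    rw [cCoeff, Nat.add_sub_cancel, Circle.coe_exp, Complex.mul_re (1 - _),
      Complex.exp_ofReal_mul_I_re, Complex.exp_ofReal_mul_I_im, Complex.sub_re, Complex.one_re,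
      Complex.sub_im, Complex.one_im]
    field_simp
    ring
  rw [← Complex.ofReal_mul, mul_assoc, ← re_eq, ← Complex.add_conj, map_mul, map_sub, map_one]

end Coefficients

section RotatedKernel

/-- Half the length of the complement of the arc `openArc ϑ₁ ϑ₂`. -/
noncomputable def arcAngle (ϑ₁ ϑ₂ : ℝ) : ℝ := (2 * Real.pi + ϑ₁ - ϑ₂) / 2

lemma circle_exp_left_endpoint (ϑ₁ ϑ₂ : ℝ) : (Circle.exp ϑ₁ : ℂ) =
    -(Circle.exp ((ϑ₁ + ϑ₂) / 2) * Circle.exp (arcAngle ϑ₁ ϑ₂)) := by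
  rw [← Circle.coe_mul, ← Circle.exp_add,
    show (ϑ₁ + ϑ₂) / 2 + arcAngle ϑ₁ ϑ₂ = ϑ₁ + Real.pi by rw [arcAngle]; ring, Circle.exp_add,
    Circle.coe_mul, Circle.coe_exp Real.pi, Complex.exp_pi_mul_I, mul_neg_one, neg_neg]

lemma circle_exp_right_endpoint (ϑ₁ ϑ₂ : ℝ) : (Circle.exp ϑ₂ : ℂ) =
    -(Circle.exp ((ϑ₁ + ϑ₂) / 2) * conj (Circle.exp (arcAngle ϑ₁ ϑ₂) : ℂ)) := by
  rw [← Circle.coe_inv_eq_conj, ← Circle.exp_neg, ← Circle.coe_mul, ← Circle.exp_add,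
    show (ϑ₁ + ϑ₂) / 2 + -arcAngle ϑ₁ ϑ₂ = ϑ₂ - Real.pi by rw [arcAngle]; ring, Circle.exp_sub,
    Circle.coe_div, Circle.coe_exp Real.pi, Complex.exp_pi_mul_I, div_neg, div_one, neg_neg]

lemma circle_exp_arcAngle_sq (ϑ₁ ϑ₂ : ℝ) : (Circle.exp (arcAngle ϑ₁ ϑ₂) : ℂ) ^ 2 =
    Circle.exp ϑ₁ * conj (Circle.exp ϑ₂ : ℂ) := by
  rw [circle_exp_left_endpoint ϑ₁ ϑ₂, circle_exp_right_endpoint ϑ₁ ϑ₂, map_neg, map_mul,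
    Complex.conj_conj]
  linear_combination (-(Circle.exp (arcAngle ϑ₁ ϑ₂) : ℂ) ^ 2) *
    circle_mul_conj (Circle.exp ((ϑ₁ + ϑ₂) / 2))

/-- The kernel value `K_n(e^{iϑ₁}, e^{iϑ₂})` multiplied by the power of
`e^{i(2π + ϑ₁ - ϑ₂)/2}` that makes it real. -/
noncomputable def rotatedKernel (μ : Measure Circle) (ϑ₁ ϑ₂ : ℝ) (n : ℕ) : ℂ :=
  Circle.exp (arcAngle ϑ₁ ϑ₂) * conj (Circle.exp (arcAngle ϑ₁ ϑ₂) : ℂ) ^ n *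
    (cdKernel μ (Circle.exp ϑ₂) n).eval (Circle.exp ϑ₁ : ℂ)

lemma eval_cdKernel_eq_mul_rotatedKernel (μ : Measure Circle) (ϑ₁ ϑ₂ : ℝ) (n : ℕ) :
    (cdKernel μ (Circle.exp ϑ₂) n).eval (Circle.exp ϑ₁ : ℂ) =
      conj (Circle.exp (arcAngle ϑ₁ ϑ₂) : ℂ) * (Circle.exp (arcAngle ϑ₁ ϑ₂) : ℂ) ^ n *
        rotatedKernel μ ϑ₁ ϑ₂ n := by
  have he := circle_mul_conj (Circle.exp (arcAngle ϑ₁ ϑ₂))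
  have hen := congrArg (· ^ (n + 1)) he
  simp only [one_pow] at hen
  rw [rotatedKernel]
  linear_combination (-(cdKernel μ (Circle.exp ϑ₂) n).eval (Circle.exp ϑ₁ : ℂ)) * hen

variable {μ : Measure Circle} {ϑ₁ ϑ₂ : ℝ}

lemma rotatedKernel_zero : rotatedKernel μ ϑ₁ ϑ₂ 0 = 0 := by
  rw [rotatedKernel, cdKernel_zero, eval_zero, mul_zero]

lemma rotatedKernel_one : rotatedKernel μ ϑ₁ ϑ₂ 1 = ((1 / normSqOPUC μ 0 : ℝ) : ℂ) := by
  rw [rotatedKernel, cdKernel_one, pow_one, circle_mul_conj, one_mul, eval_C, Complex.ofReal_div,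
    Complex.ofReal_one]

variable [IsFiniteMeasure μ]

lemma rotatedKernel_recurrence (hμ : μ.support.Infinite) (hne : Circle.exp ϑ₁ ≠ Circle.exp ϑ₂)
    (n : ℕ) : ((1 - gCoeff (verblunsky μ) ϑ₂ (n + 1) : ℝ) : ℂ) * rotatedKernel μ ϑ₁ ϑ₂ (n + 2) =
      ((Real.cos (arcAngle ϑ₁ ϑ₂) - cCoeff (verblunsky μ) ϑ₂ (n + 1) *
          Real.sin (arcAngle ϑ₁ ϑ₂) : ℝ) : ℂ) * rotatedKernel μ ϑ₁ ϑ₂ (n + 1) -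
        (gCoeff (verblunsky μ) ϑ₂ (n + 1) : ℂ) * rotatedKernel μ ϑ₁ ϑ₂ n := by
  have hα := norm_verblunsky_lt_one hμ
  set e := (Circle.exp (arcAngle ϑ₁ ϑ₂) : ℂ) with he_def
  set a := tau (verblunsky μ) ϑ₂ n * verblunsky μ n with ha
  have he : e * conj e = 1 := circle_mul_conj _
  have factor_pos := mul_pos two_pos (one_sub_re_tau_mul_pos hα ϑ₂ n)
  have hg : ((2 * (1 - a.re) : ℝ) : ℂ) * gCoeff (verblunsky μ) ϑ₂ (n + 1) =
      (1 - a) * (1 - conj a) := by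
    rw [← Complex.ofReal_mul, two_mul_one_sub_re_mul_gCoeff hα, Complex.ofReal_pow,
      ← Complex.mul_conj', map_sub, map_one]
  have hg' : ((2 * (1 - a.re) : ℝ) : ℂ) * (1 - gCoeff (verblunsky μ) ϑ₂ (n + 1) : ℝ) =
      1 - a * conj a := by
    rw [← Complex.ofReal_mul, two_mul_one_sub_re_mul_one_sub_gCoeff hα, Complex.mul_conj',
      Complex.ofReal_sub, Complex.ofReal_one, Complex.ofReal_pow]
  have hc := two_mul_one_sub_re_mul_cos_sub hα ϑ₂ n (arcAngle ϑ₁ ϑ₂)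
  rw [← ha, ← he_def] at hc
  have hrec := cdKernel_recurrence hμ ϑ₂ n hne ha (circle_exp_arcAngle_sq ϑ₁ ϑ₂)
  refine mul_left_cancel₀ (Complex.ofReal_ne_zero.2 factor_pos.ne') ?_
  rw [rotatedKernel, rotatedKernel, rotatedKernel]
  simp only [← he_def]
  linear_combination e * conj e ^ (n + 2) *
      (cdKernel μ (Circle.exp ϑ₂) (n + 2)).eval (Circle.exp ϑ₁ : ℂ) * hg' -
    e * conj e ^ (n + 1) * (cdKernel μ (Circle.exp ϑ₂) (n + 1)).eval (Circle.exp ϑ₁ : ℂ) * hc +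
    e * conj e ^ n * (cdKernel μ (Circle.exp ϑ₂) n).eval (Circle.exp ϑ₁ : ℂ) * hg +
    e * conj e ^ (n + 2) * hrec +
    ((1 - a) * e ^ 2 * conj e ^ (n + 1) *
        (cdKernel μ (Circle.exp ϑ₂) (n + 1)).eval (Circle.exp ϑ₁ : ℂ) -
      (1 - a) * (1 - conj a) * e * conj e ^ n * (e * conj e + 1) *
        (cdKernel μ (Circle.exp ϑ₂) n).eval (Circle.exp ϑ₁ : ℂ)) * he

lemma rotatedKernel_im (hμ : μ.support.Infinite) (hne : Circle.exp ϑ₁ ≠ Circle.exp ϑ₂) (n : ℕ) :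
    (rotatedKernel μ ϑ₁ ϑ₂ n).im = 0 := by
  induction n using Nat.twoStepInduction with
  | zero => rw [rotatedKernel_zero, Complex.zero_im]
  | one => rw [rotatedKernel_one, Complex.ofReal_im]
  | more n ih₀ ih₁ =>
    have h := congrArg Complex.im (rotatedKernel_recurrence hμ hne n)
    rw [Complex.sub_im, Complex.im_ofReal_mul, Complex.im_ofReal_mul, Complex.im_ofReal_mul, ih₀,
      ih₁, mul_zero, mul_zero, sub_zero] at h
    exact (mul_eq_zero.1 h).resolve_left
      (sub_pos.2 (gCoeff_succ_lt_one (norm_verblunsky_lt_one hμ) ϑ₂ n)).ne'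

lemma rotatedKernel_re_recurrence (hμ : μ.support.Infinite)
    (hne : Circle.exp ϑ₁ ≠ Circle.exp ϑ₂) (n : ℕ) :
    (1 - gCoeff (verblunsky μ) ϑ₂ (n + 1)) * (rotatedKernel μ ϑ₁ ϑ₂ (n + 2)).re =
      (Real.cos (arcAngle ϑ₁ ϑ₂) - cCoeff (verblunsky μ) ϑ₂ (n + 1) *
          Real.sin (arcAngle ϑ₁ ϑ₂)) * (rotatedKernel μ ϑ₁ ϑ₂ (n + 1)).re -
        gCoeff (verblunsky μ) ϑ₂ (n + 1) * (rotatedKernel μ ϑ₁ ϑ₂ n).re := by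
  have h := congrArg Complex.re (rotatedKernel_recurrence hμ hne n)
  rwa [Complex.sub_re, Complex.re_ofReal_mul, Complex.re_ofReal_mul, Complex.re_ofReal_mul] at h

lemma eval_cdKernel_eq_mul_ofReal (hμ : μ.support.Infinite)
    (hne : Circle.exp ϑ₁ ≠ Circle.exp ϑ₂) (n : ℕ) :
    (cdKernel μ (Circle.exp ϑ₂) n).eval (Circle.exp ϑ₁ : ℂ) =
      conj (Circle.exp (arcAngle ϑ₁ ϑ₂) : ℂ) * (Circle.exp (arcAngle ϑ₁ ϑ₂) : ℂ) ^ n *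
        (rotatedKernel μ ϑ₁ ϑ₂ n).re := by
  rw [eval_cdKernel_eq_mul_rotatedKernel,
    ← Complex.re_add_im (rotatedKernel μ ϑ₁ ϑ₂ n), rotatedKernel_im hμ hne]
  simp

end RotatedKernel

section ArcWeight

/-- The trigonometric polynomial `2 (cos ((ϑ₂ - ϑ₁) / 2) - cos (θ - (ϑ₁ + ϑ₂) / 2))` at
`z = e^{iθ}`, whose sign tells whether `z` lies on the arc `openArc ϑ₁ ϑ₂`. -/
noncomputable def arcWeight (ϑ₁ ϑ₂ : ℝ) : C(Circle, ℝ) where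
  toFun z := 2 * (Real.cos ((ϑ₂ - ϑ₁) / 2) - ((z / Circle.exp ((ϑ₁ + ϑ₂) / 2) : Circle) : ℂ).re)
  continuous_toFun := by fun_prop

lemma arcWeight_apply (ϑ₁ ϑ₂ : ℝ) (z : Circle) : arcWeight ϑ₁ ϑ₂ z =
    2 * (Real.cos ((ϑ₂ - ϑ₁) / 2) - ((z / Circle.exp ((ϑ₁ + ϑ₂) / 2) : Circle) : ℂ).re) :=
  rfl

lemma coe_arcWeight (ϑ₁ ϑ₂ : ℝ) (z : Circle) : (arcWeight ϑ₁ ϑ₂ z : ℂ) =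
    -conj (Circle.exp (arcAngle ϑ₁ ϑ₂) : ℂ) * (z - (Circle.exp ϑ₁ : ℂ)) *
      conj (z - (Circle.exp ϑ₂ : ℂ)) := by
  have cos_eq : Real.cos ((ϑ₂ - ϑ₁) / 2) = -(Circle.exp (arcAngle ϑ₁ ϑ₂) : ℂ).re := by
    rw [Circle.coe_exp, Complex.exp_ofReal_mul_I_re, ← Real.cos_pi_sub, arcAngle]
    ring_nf
  set e := (Circle.exp (arcAngle ϑ₁ ϑ₂) : ℂ) with he_def
  set c := (Circle.exp ((ϑ₁ + ϑ₂) / 2) : ℂ) with hc_def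
  have he : e * conj e = 1 := circle_mul_conj _
  have hc : c * conj c = 1 := circle_mul_conj _
  rw [arcWeight_apply, cos_eq, mul_sub, mul_neg, Complex.ofReal_sub, Complex.ofReal_neg,
    ← Complex.add_conj, ← Complex.add_conj, div_eq_mul_inv, Circle.coe_mul,
    Circle.coe_inv_eq_conj, circle_exp_left_endpoint ϑ₁ ϑ₂, circle_exp_right_endpoint ϑ₁ ϑ₂,
    ← he_def, ← hc_def]
  simp only [map_sub, map_neg, map_mul, Complex.conj_conj]
  linear_combination conj e * circle_mul_conj z +
    (z * conj c + c * conj (z : ℂ) + e * c * conj c) * he + e * hc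

lemma arcWeight_eq_sub_cos_arg (ϑ₁ ϑ₂ : ℝ) (z : Circle) : arcWeight ϑ₁ ϑ₂ z =
    2 * (Real.cos ((ϑ₂ - ϑ₁) / 2) -
      Real.cos |Complex.arg ((z / Circle.exp ((ϑ₁ + ϑ₂) / 2) : Circle) : ℂ)|) := by
  rw [Real.cos_abs, Complex.cos_arg (Circle.coe_ne_zero _), Circle.norm_coe, div_one,
    arcWeight_apply]

variable {ϑ₁ ϑ₂ : ℝ}

lemma mem_openArc_iff_abs_arg_lt (hle : ϑ₂ - ϑ₁ ≤ 2 * Real.pi) {z : Circle} :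
    z ∈ openArc ϑ₁ ϑ₂ ↔
      |Complex.arg ((z / Circle.exp ((ϑ₁ + ϑ₂) / 2) : Circle) : ℂ)| < (ϑ₂ - ϑ₁) / 2 := by
  constructor
  · rintro ⟨θ, ⟨h₁, h₂⟩, rfl⟩
    rw [← Circle.exp_sub, Circle.arg_exp (by linarith) (by linarith), abs_lt]
    constructor <;> linarith
  · rw [abs_lt]
    rintro ⟨h₁, h₂⟩
    refine ⟨(ϑ₁ + ϑ₂) / 2 + Complex.arg (z / Circle.exp ((ϑ₁ + ϑ₂) / 2) : Circle),
      ⟨by linarith, by linarith⟩, ?_⟩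
    rw [Circle.exp_add, Circle.exp_arg, mul_div_cancel]

lemma arcWeight_neg_iff (hpos : 0 ≤ ϑ₂ - ϑ₁) (hle : ϑ₂ - ϑ₁ ≤ 2 * Real.pi) {z : Circle} :
    arcWeight ϑ₁ ϑ₂ z < 0 ↔ z ∈ openArc ϑ₁ ϑ₂ := by
  rw [arcWeight_eq_sub_cos_arg, ← smul_eq_mul, smul_neg_iff_of_pos_left two_pos, sub_neg,
    mem_openArc_iff_abs_arg_lt hle]
  exact Real.strictAntiOn_cos.lt_iff_gt ⟨by linarith, by linarith⟩
    ⟨abs_nonneg _, Complex.abs_arg_le_pi _⟩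

lemma arcWeight_nonpos (h : ϑ₂ - ϑ₁ = 2 * Real.pi) (z : Circle) : arcWeight ϑ₁ ϑ₂ z ≤ 0 := by
  rw [arcWeight_eq_sub_cos_arg, h, mul_div_cancel_left₀ _ two_ne_zero, Real.cos_pi]
  linarith [Real.neg_one_le_cos |Complex.arg ((z / Circle.exp ((ϑ₁ + ϑ₂) / 2) : Circle) : ℂ)|]

lemma finite_arcWeight_eq_zero (ϑ₁ ϑ₂ : ℝ) : {z | arcWeight ϑ₁ ϑ₂ z = 0}.Finite := by
  refine (Set.toFinite {Circle.exp ϑ₁, Circle.exp ϑ₂}).subset fun z hz => ?_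
  have h := coe_arcWeight ϑ₁ ϑ₂ z
  rw [show arcWeight ϑ₁ ϑ₂ z = 0 from hz,
    Complex.ofReal_zero, eq_comm, mul_eq_zero, mul_eq_zero, map_eq_zero,
    sub_eq_zero, sub_eq_zero, neg_eq_zero, map_eq_zero] at h
  simpa [Circle.ext_iff] using h

lemma inter_openArc_eq_empty_iff (S : Set Circle) (hpos : 0 ≤ ϑ₂ - ϑ₁)
    (hle : ϑ₂ - ϑ₁ ≤ 2 * Real.pi) :
    S ∩ openArc ϑ₁ ϑ₂ = ∅ ↔ ∀ z ∈ S, 0 ≤ arcWeight ϑ₁ ϑ₂ z := by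
  rw [← Set.disjoint_iff_inter_eq_empty, Set.disjoint_left]
  simp only [← arcWeight_neg_iff hpos hle, not_lt]

lemma circle_exp_ne_circle_exp (hpos : 0 < ϑ₂ - ϑ₁) (hlt : ϑ₂ - ϑ₁ < 2 * Real.pi) :
    Circle.exp ϑ₁ ≠ Circle.exp ϑ₂ :=
  (Circle.exp_injOn_Icc hlt).ne (Set.left_mem_Icc.2 (by linarith)) (Set.right_mem_Icc.2
    (by linarith)) (by linarith)

lemma sesqForm_arcWeight (μ : Measure Circle) [IsFiniteMeasure μ] (ϑ₁ ϑ₂ : ℝ) (p q : ℂ[X]) :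
    sesqForm μ (arcWeight ϑ₁ ϑ₂) q p = -conj (Circle.exp (arcAngle ϑ₁ ϑ₂) : ℂ) *
      ip μ ((X - C (Circle.exp ϑ₁ : ℂ)) * p) ((X - C (Circle.exp ϑ₂ : ℂ)) * q) := by
  rw [sesqForm_apply, ip, ← integral_const_mul]
  congr 1 with z
  rw [coe_arcWeight]
  simp only [eval_mul, eval_sub, eval_X, eval_C, map_mul]
  ring

end ArcWeight

section Gap

open scoped ComplexOrder

variable {μ : Measure Circle} {ϑ₁ ϑ₂ : ℝ} [IsFiniteMeasure μ]

lemma christoffelPoly_coeff_ne_zero_iff (hμ : μ.support.Infinite)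
    (hne : Circle.exp ϑ₁ ≠ Circle.exp ϑ₂) (n : ℕ) :
    (christoffelPoly μ (Circle.exp ϑ₁) (Circle.exp ϑ₂) n).coeff n ≠ 0 ↔
      (rotatedKernel μ ϑ₁ ϑ₂ (n + 1)).re ≠ 0 := by
  rw [coeff_christoffelPoly, eval_cdKernel_eq_mul_ofReal hμ hne, mul_ne_zero_iff, mul_ne_zero_iff,
    Complex.ofReal_ne_zero]
  simp

lemma sesqForm_arcWeight_christoffelPoly (hμ : μ.support.Infinite)
    (hne : Circle.exp ϑ₁ ≠ Circle.exp ϑ₂) {n : ℕ} {q : ℂ[X]} (hq : q ∈ degreeLT ℂ (n + 1)) :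
    sesqForm μ (arcWeight ϑ₁ ϑ₂) q (christoffelPoly μ (Circle.exp ϑ₁) (Circle.exp ϑ₂) n) =
      -(Circle.exp (arcAngle ϑ₁ ϑ₂) : ℂ) ^ n * (rotatedKernel μ ϑ₁ ϑ₂ (n + 2)).re *
        (conj (q.coeff n) * normSqOPUC μ (n + 1)) := by
  rw [sesqForm_arcWeight, ip_X_sub_C_mul_christoffelPoly _ _ hμ hq,
    eval_cdKernel_eq_mul_ofReal hμ hne]
  set e := (Circle.exp (arcAngle ϑ₁ ϑ₂) : ℂ)
  have he : e * conj e = 1 := circle_mul_conj _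
  linear_combination (-e ^ n * (rotatedKernel μ ϑ₁ ϑ₂ (n + 2)).re *
    (conj (q.coeff n) * normSqOPUC μ (n + 1)) * (e * conj e + 1)) * he

lemma sesqForm_arcWeight_christoffelPoly_self (hμ : μ.support.Infinite)
    (hne : Circle.exp ϑ₁ ≠ Circle.exp ϑ₂) (n : ℕ) :
    sesqForm μ (arcWeight ϑ₁ ϑ₂) (christoffelPoly μ (Circle.exp ϑ₁) (Circle.exp ϑ₂) n)
        (christoffelPoly μ (Circle.exp ϑ₁) (Circle.exp ϑ₂) n) =
      ((-((rotatedKernel μ ϑ₁ ϑ₂ (n + 1)).re * (rotatedKernel μ ϑ₁ ϑ₂ (n + 2)).re) *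
        normSqOPUC μ (n + 1) : ℝ) : ℂ) := by
  rw [sesqForm_arcWeight_christoffelPoly hμ hne (christoffelPoly_mem_degreeLT _ _ _ _),
    coeff_christoffelPoly, eval_cdKernel_eq_mul_ofReal hμ hne]
  set e := (Circle.exp (arcAngle ϑ₁ ϑ₂) : ℂ)
  have he : (e * conj e) ^ (n + 1) = 1 := by rw [circle_mul_conj, one_pow]
  simp only [map_mul, map_pow, Complex.conj_conj, Complex.conj_ofReal, Complex.ofReal_mul,
    Complex.ofReal_neg]
  linear_combination (-(rotatedKernel μ ϑ₁ ϑ₂ (n + 1)).re * (rotatedKernel μ ϑ₁ ϑ₂ (n + 2)).re *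
    normSqOPUC μ (n + 1) : ℂ) * he

lemma rotatedKernel_mul_neg_of_ne_zero (hμ : μ.support.Infinite)
    (hne : Circle.exp ϑ₁ ≠ Circle.exp ϑ₂) (hB : (sesqForm μ (arcWeight ϑ₁ ϑ₂)).IsNonneg) {n : ℕ}
    (hn : (rotatedKernel μ ϑ₁ ϑ₂ (n + 1)).re ≠ 0) :
    (rotatedKernel μ ϑ₁ ϑ₂ (n + 1)).re * (rotatedKernel μ ϑ₁ ϑ₂ (n + 2)).re < 0 := by
  set p := christoffelPoly μ (Circle.exp ϑ₁) (Circle.exp ϑ₂) n with hp_def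
  have hself := sesqForm_arcWeight_christoffelPoly_self hμ hne n
  rw [← hp_def] at hself
  have hp : p ≠ 0 := fun h =>
    (christoffelPoly_coeff_ne_zero_iff hμ hne n).2 hn (by rw [← hp_def, h, coeff_zero])
  have hform_ne : sesqForm μ (arcWeight ϑ₁ ϑ₂) p p ≠ 0 := fun h => hp <|
    eq_zero_of_sesqForm_self_eq_zero hμ (isNonneg_sesqForm_iff.1 hB)
      (finite_arcWeight_eq_zero ϑ₁ ϑ₂) h
  have hform_pos := lt_of_le_of_ne (hB.nonneg p) hform_ne.symm
  rw [hself, Complex.zero_lt_real] at hform_pos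
  exact neg_pos.1 (pos_of_mul_pos_left hform_pos (normSqOPUC_pos hμ (n + 1)).le)

lemma isNonneg_sesqForm_arcWeight_iff (hμ : μ.support.Infinite)
    (hne : Circle.exp ϑ₁ ≠ Circle.exp ϑ₂) :
    (sesqForm μ (arcWeight ϑ₁ ϑ₂)).IsNonneg ↔ ∀ n : ℕ,
      (rotatedKernel μ ϑ₁ ϑ₂ (n + 1)).re * (rotatedKernel μ ϑ₁ ϑ₂ (n + 2)).re < 0 := by
  constructor
  · intro hB
    have kernel_ne : ∀ n : ℕ, (rotatedKernel μ ϑ₁ ϑ₂ (n + 1)).re ≠ 0 := by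
      intro n
      induction n with
      | zero =>
        rw [rotatedKernel_one, Complex.ofReal_re]
        exact (one_div_pos.2 (normSqOPUC_pos hμ 0)).ne'
      | succ n ih =>
        exact right_ne_zero_of_mul (rotatedKernel_mul_neg_of_ne_zero hμ hne hB ih).ne
    exact fun n => rotatedKernel_mul_neg_of_ne_zero hμ hne hB (kernel_ne n)
  · intro h
    refine isNonneg_of_orthogonal (isSymm_sesqForm μ _)
      (f := christoffelPoly μ (Circle.exp ϑ₁) (Circle.exp ϑ₂))
      (christoffelPoly_mem_degreeLT μ _ _)
      (fun n => (christoffelPoly_coeff_ne_zero_iff hμ hne n).2 (left_ne_zero_of_mul (h n).ne))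
      (fun n q hq => ?_) (fun n => ?_)
    · rw [sesqForm_arcWeight_christoffelPoly hμ hne (degreeLT_mono n.le_succ hq),
        coeff_eq_zero_of_mem_degreeLT hq le_rfl, map_zero, zero_mul, mul_zero]
    · rw [sesqForm_arcWeight_christoffelPoly_self hμ hne, Complex.zero_le_real]
      exact mul_nonneg (neg_pos.2 (h n)).le (normSqOPUC_pos hμ (n + 1)).le

lemma sin_arcAngle_pos (hpos : 0 < ϑ₂ - ϑ₁) (hlt : ϑ₂ - ϑ₁ < 2 * Real.pi) :
    0 < Real.sin (arcAngle ϑ₁ ϑ₂) :=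
  Real.sin_pos_of_pos_of_lt_pi (by rw [arcAngle]; linarith) (by rw [arcAngle]; linarith)

lemma cotTop_arcAngle_lt_iff (hpos : 0 < ϑ₂ - ϑ₁) (hlt : ϑ₂ - ϑ₁ < 2 * Real.pi) (c : ℝ) :
    cotTop (arcAngle ϑ₁ ϑ₂) < (c : EReal) ↔
      Real.cos (arcAngle ϑ₁ ϑ₂) - c * Real.sin (arcAngle ϑ₁ ϑ₂) < 0 := by
  rw [cotTop, if_neg (by rw [arcAngle]; linarith), EReal.coe_lt_coe_iff,
    Real.cot_eq_cos_div_sin, div_lt_iff₀ (sin_arcAngle_pos hpos hlt), sub_neg]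

lemma mSeq_succ (hpos : 0 < ϑ₂ - ϑ₁) (hlt : ϑ₂ - ϑ₁ < 2 * Real.pi) (α : ℕ → ℂ) (n : ℕ) :
    mSeq α ϑ₁ ϑ₂ (n + 1) = (1 - gCoeff α ϑ₂ (n + 1)) * gCoeff α ϑ₂ (n + 2) /
      ((Real.cos (arcAngle ϑ₁ ϑ₂) - cCoeff α ϑ₂ (n + 1) * Real.sin (arcAngle ϑ₁ ϑ₂)) *
        (Real.cos (arcAngle ϑ₁ ϑ₂) - cCoeff α ϑ₂ (n + 2) * Real.sin (arcAngle ϑ₁ ϑ₂))) /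
      (1 - mSeq α ϑ₁ ϑ₂ n) := by
  rw [mSeq, dFrakSucc, dSucc, xPoint, ← arcAngle,
    ← Real.abs_sin_eq_sqrt_one_sub_cos_sq, abs_of_pos (sin_arcAngle_pos hpos hlt)]

lemma rotatedKernel_alternating_iff (hμ : μ.support.Infinite) (hpos : 0 < ϑ₂ - ϑ₁)
    (hlt : ϑ₂ - ϑ₁ < 2 * Real.pi) :
    (∀ n : ℕ, (rotatedKernel μ ϑ₁ ϑ₂ (n + 1)).re * (rotatedKernel μ ϑ₁ ϑ₂ (n + 2)).re < 0) ↔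
      cotTop (arcAngle ϑ₁ ϑ₂) < (cCoeff (verblunsky μ) ϑ₂ 1 : EReal) ∧
        ∀ n : ℕ, 0 < mSeq (verblunsky μ) ϑ₁ ϑ₂ (n + 1) ∧
          mSeq (verblunsky μ) ϑ₁ ϑ₂ (n + 1) < 1 := by
  have hα := norm_verblunsky_lt_one hμ
  rw [cotTop_arcAngle_lt_iff hpos hlt]
  refine alternating_iff_chain_parameters (G := fun n => gCoeff (verblunsky μ) ϑ₂ (n + 1))
    (V := fun n => (rotatedKernel μ ϑ₁ ϑ₂ n).re)
    (y := fun n => Real.cos (arcAngle ϑ₁ ϑ₂) - cCoeff (verblunsky μ) ϑ₂ (n + 1) *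
      Real.sin (arcAngle ϑ₁ ϑ₂))
    (fun n => ⟨gCoeff_succ_pos hα ϑ₂ n, gCoeff_succ_lt_one hα ϑ₂ n⟩)
    (rotatedKernel_re_recurrence hμ (circle_exp_ne_circle_exp hpos hlt)) ?_ ?_ rfl
    (mSeq_succ hpos hlt _)
  · rw [rotatedKernel_zero, Complex.zero_re]
  · rw [rotatedKernel_one, Complex.ofReal_re]
    exact (one_div_pos.2 (normSqOPUC_pos hμ 0)).ne'

omit [IsFiniteMeasure μ] in
lemma support_inter_openArc_ne_empty (hμ : μ.support.Infinite) (h : ϑ₂ - ϑ₁ = 2 * Real.pi) :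
    μ.support ∩ openArc ϑ₁ ϑ₂ ≠ ∅ := by
  rw [Ne, inter_openArc_eq_empty_iff _ (h ▸ Real.two_pi_pos.le) h.le]
  intro hs
  exact hμ ((finite_arcWeight_eq_zero ϑ₁ ϑ₂).subset fun z hz =>
    (arcWeight_nonpos h z).antisymm (hs z hz))

lemma support_inter_openArc_eq_empty_iff (hμ : μ.support.Infinite) (hpos : 0 < ϑ₂ - ϑ₁)
    (hlt : ϑ₂ - ϑ₁ < 2 * Real.pi) :
    μ.support ∩ openArc ϑ₁ ϑ₂ = ∅ ↔ ∀ n : ℕ,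
      (rotatedKernel μ ϑ₁ ϑ₂ (n + 1)).re * (rotatedKernel μ ϑ₁ ϑ₂ (n + 2)).re < 0 := by
  rw [inter_openArc_eq_empty_iff _ hpos.le hlt.le, ← isNonneg_sesqForm_iff,
    isNonneg_sesqForm_arcWeight_iff hμ (circle_exp_ne_circle_exp hpos hlt)]

end Gap

end RotatedOPUC

theorem mainTheorem2 (μ : MeasureTheory.Measure Circle) [MeasureTheory.IsFiniteMeasure μ]
    (hμ : μ.support.Infinite) (ϑ₁ ϑ₂ : ℝ)
    (hpos : 0 < ϑ₂ - ϑ₁) (hle : ϑ₂ - ϑ₁ ≤ 2 * Real.pi) (hϑ₂ : 0 < ϑ₂) :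
    μ.support ∩ RotatedOPUC.openArc ϑ₁ ϑ₂ = ∅ ↔
      RotatedOPUC.cotTop ((2 * Real.pi + ϑ₁ - ϑ₂) / 2) <
          (RotatedOPUC.cCoeff (RotatedOPUC.verblunsky μ) ϑ₂ 1 : EReal) ∧
        ∀ n : ℕ, 1 ≤ n →
          0 < RotatedOPUC.mSeq (RotatedOPUC.verblunsky μ) ϑ₁ ϑ₂ n ∧
            RotatedOPUC.mSeq (RotatedOPUC.verblunsky μ) ϑ₁ ϑ₂ n < 1 := by
  rw [← RotatedOPUC.arcAngle]
  rcases hle.eq_or_lt with hfull | hlt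
  · refine iff_of_false (RotatedOPUC.support_inter_openArc_ne_empty hμ hfull) fun h => ?_
    have harc : RotatedOPUC.arcAngle ϑ₁ ϑ₂ = 0 := by rw [RotatedOPUC.arcAngle]; linarith
    rw [harc, RotatedOPUC.cotTop, if_pos rfl] at h
    exact not_top_lt h.1
  · rw [RotatedOPUC.support_inter_openArc_eq_empty_iff hμ hpos hlt,
      RotatedOPUC.rotatedKernel_alternating_iff hμ hpos hlt]
    refine and_congr_right' ⟨fun h n hn => ?_, fun h n => h (n + 1) n.succ_pos⟩
    obtain ⟨k, rfl⟩ := Nat.exists_eq_succ_of_ne_zero (Nat.one_le_iff_ne_zero.1 hn)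
    exact h k
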